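/- All rings are associative and unital (they may be algebras over a commutative ring $k$; $k$ plays no role). Let $A$, $L$ be rings, $(\mathcal C,\Delta_{\mathcal C},\epsilon_{\mathcal C})$ an $A$-coring and $(\mathcal D,\Delta_{\mathcal D},\epsilon_{\mathcal D})$ an $L$-coring, i.e. comonoids in the categories of $A$-$A$ and of $L$-$L$ bimodules. Write $\Delta_{\mathcal C}(c)=c^{(1)}\otimes_A c^{(2)}$. Let $(\mathcal D:L)$ be a right coring extension of $(\mathcal C:A)$: $\mathcal C$ is also a right $\mathcal D$-comodule, with a left $A$-linear coaction $\tau_{\mathcal C}(c)=c_{[0]}\otimes_L c_{[1]}$ (in particular $\mathcal C$ is an $A$-$L$ bimodule), such that $\Delta_{\mathcal C}$ is right $L$-linear and $(\Delta_{\mathcal C}\otimes_L\mathcal D)\circ\tau_{\mathcal C}=(\mathcal C\otimes_A\tau_{\mathcal C})\circ\Delta_{\mathcal C}$. Every right $\mathcal C$-comodule $M$, with coaction $\varrho(m)=m^{[0]}\otimes_A m^{[1]}$, is then a right $L$-module by $ml=m^{[0]}\epsilon_{\mathcal C}(m^{[1]}l)$. Assume that the extension is pure: for every right $\mathcal C$-comodule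 $M$ the functor $-\otimes_L\mathcal D\otimes_L\mathcal D$ preserves the equaliser $M\xrightarrow{\varrho} M\otimes_A\mathcal C\rightrightarrows M\otimes_A\mathcal C\otimes_A\mathcal C$ of $\varrho\otimes_A\mathcal C$ and $M\otimes_A\Delta_{\mathcal C}$ in the category of right $L$-modules. Then every right $\mathcal C$-comodule $M$ is a right $\mathcal D$-comodule, with coaction $\tau_M:M\to M\otimes_L\mathcal D$ uniquely determined by $(\varrho\otimes_L\mathcal D)\circ\tau_M=(M\otimes_A\tau_{\mathcal C})\circ\varrho$. Let $\Sigma$ be an $L$-$\mathcal C$ bicomodule, i.e. an $L$-$A$ bimodule and a right $\mathcal C$-comodule with left $L$-linear coaction. Let $T=\mathrm{End}^{\mathcal C}(\Sigma)$, an $L$-ring by $l\mapsto(x\mapsto lx)$, and let $\Sigma^*=\mathrm{Hom}_A(\Sigma,A)$ be the $A$-$L$ bimodule with $(a\xi l)(x)=a\,\xi(lx)$. Let ${}_L\mathrm{Hom}^{\mathcal D}(\mathcal D,\Sigma)$ be the set of left $L$-linear right $\mathcal D$-colinear maps, and let $\widetilde Q$ be the set of $A$-$L$ bilinear maps $q:\mathcal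 C\to\Sigma^*$ with $c^{(1)}q(c^{(2)})(x)=q(c)(x^{[0]})x^{[1]}$ for all $x\in\Sigma$, $c\in\mathcal C$. Then: - $\Sigma$ is *weak cleft* if there are $j\in{}_L\mathrm{Hom}^{\mathcal D}(\mathcal D,\Sigma)$ and $\tilde\jmath\in\widetilde Q$ such that $c^{(1)}\,\tilde\jmath\big(c^{(2)}{}_{[0]}\big)\big(j(c^{(2)}{}_{[1]})\big)=c$ for all $c\in\mathcal C$; - $\Sigma$ is *cleft* if such $j,\tilde\jmath$ can be chosen with, in addition, $j(d)^{[0]}\,\tilde\jmath\big(j(d)^{[1]}\big)(x)=\epsilon_{\mathcal D}(d)x$ for all $d\in\mathcal D$, $x\in\Sigma$; - $\Sigma$ is a *Galois $\mathcal C$-comodule* if for every right $A$-module $N$ the canonical map $\mathrm{Hom}_A(\Sigma,N)\otimes_T\Sigma\to N\otimes_A\mathcal C$, $\phi\otimes_T x\mapsto\phi(x^{[0]})\otimes_A x^{[1]}$, is an isomorphism; - $\Sigma$ has the *normal basis property* if $\Sigma\cong T\otimes_L\mathcal D$ as $T$-$\mathcal D$ bicomodules (left $T$-linear and right $\mathcal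 D$-colinear isomorphism), and the *weak normal basis property* if, as a $T$-$\mathcal D$ bicomodule, $\Sigma$ is isomorphic to a direct summand of $T\otimes_L\mathcal D$. Here $\Sigma$ has the $\mathcal D$-coaction $\tau_\Sigma$ and $T\otimes_L\mathcal D$ has the coaction $T\otimes_L\Delta_{\mathcal D}$. **Theorem.** (1) $\Sigma$ is weak cleft if and only if it is a Galois $\mathcal C$-comodule and has the weak normal basis property. (2) $\Sigma$ is cleft if and only if it is a Galois $\mathcal C$-comodule and has the normal basis property. -/

import Mathlib

open scoped TensorProduct
open MulOpposite

universe u v w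

/-- An additive map that is compatible with the scalars, as a linear map. -/
def linOf {R M N : Type*} [Ring R] [AddCommGroup M] [AddCommGroup N] [Module R M] [Module R N]
    (f : M →+ N) (h : ∀ (r : R) (m : M), f (r • m) = r • f m) : M →ₗ[R] N :=
  { f with map_smul' := h }

@[simp] theorem linOf_apply {R M N : Type*} [Ring R] [AddCommGroup M] [AddCommGroup N]
    [Module R M] [Module R N] (f : M →+ N) (h : ∀ (r : R) (m : M), f (r • m) = r • f m) (m : M) :
    linOf f h m = f m := rfl

/-- The tensor product `M ⊗_R N` of a right module `M` and a left module `N` over a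
noncommutative ring `R`: the quotient of `M ⊗_ℤ N` by the relations `(m r) ⊗ n = m ⊗ (r n)`.
Right `R`-modules are modules over `Rᵐᵒᵖ`, so `m r` is written `op r • m`. -/
def BalTensor (R : Type*) (M : Type*) (N : Type*) [Ring R] [AddCommGroup M] [Module Rᵐᵒᵖ M]
    [AddCommGroup N] [Module R N] : Type _ :=
  (M ⊗[ℤ] N) ⧸ AddSubgroup.closure
    {x : M ⊗[ℤ] N | ∃ (m : M) (r : R) (n : N), x = (op r • m) ⊗ₜ[ℤ] n - m ⊗ₜ[ℤ] (r • n)}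

namespace BalTensor

section Basic

variable {R : Type*} {M M' M'' : Type*} {N N' N'' : Type*} {P : Type*} [Ring R]
  [AddCommGroup M] [Module Rᵐᵒᵖ M] [AddCommGroup M'] [Module Rᵐᵒᵖ M']
  [AddCommGroup M''] [Module Rᵐᵒᵖ M''] [AddCommGroup N] [Module R N]
  [AddCommGroup N'] [Module R N'] [AddCommGroup N''] [Module R N''] [AddCommGroup P]

instance : AddCommGroup (BalTensor R M N) :=
  inferInstanceAs (AddCommGroup ((M ⊗[ℤ] N) ⧸ AddSubgroup.closure
    {x : M ⊗[ℤ] N | ∃ (m : M) (r : R) (n : N), x = (op r • m) ⊗ₜ[ℤ] n - m ⊗ₜ[ℤ] (r • n)}))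

/-- The class of `m ⊗ n`. -/
def tmul (R : Type*) {M : Type*} {N : Type*} [Ring R] [AddCommGroup M] [Module Rᵐᵒᵖ M]
    [AddCommGroup N] [Module R N] (m : M) (n : N) : BalTensor R M N :=
  QuotientAddGroup.mk (m ⊗ₜ[ℤ] n)

theorem add_tmul (m m' : M) (n : N) : tmul R (m + m') n = tmul R m n + tmul R m' n := by
  unfold tmul
  rw [TensorProduct.add_tmul]
  rfl

theorem tmul_add (m : M) (n n' : N) : tmul R m (n + n') = tmul R m n + tmul R m n' := by
  unfold tmul
  rw [TensorProduct.tmul_add]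
  rfl

@[simp] theorem zero_tmul (n : N) : tmul R (0 : M) n = 0 := by
  simpa using add_tmul (R := R) (0 : M) 0 n

@[simp] theorem tmul_zero (m : M) : tmul R m (0 : N) = 0 := by
  simpa using tmul_add (R := R) m (0 : N) 0

theorem smul_tmul (r : R) (m : M) (n : N) : tmul R (op r • m) n = tmul R m (r • n) := by
  unfold tmul
  refine QuotientAddGroup.eq_iff_sub_mem.mpr (AddSubgroup.subset_closure ?_)
  exact ⟨m, r, n, rfl⟩

@[elab_as_elim]
theorem induction_on {motive : BalTensor R M N → Prop} (x : BalTensor R M N)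
    (zero : motive 0) (tmul : ∀ m n, motive (tmul R m n))
    (add : ∀ x y, motive x → motive y → motive (x + y)) : motive x := by
  induction x using QuotientAddGroup.induction_on with
  | H z =>
    induction z using TensorProduct.induction_on with
    | zero => exact zero
    | tmul m n => exact tmul m n
    | add x y hx hy => exact add _ _ hx hy

/-- A biadditive balanced map factors through the tensor product. -/
def lift (f : M →+ N →+ P) (h : ∀ (r : R) (m : M) (n : N), f (op r • m) n = f m (r • n)) :
    BalTensor R M N →+ P :=
  QuotientAddGroup.lift _
    (TensorProduct.liftAddHom f (fun r m n => by simp))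
    (by
      rw [AddSubgroup.closure_le]
      rintro _ ⟨m, r, n, rfl⟩
      simp [h])

@[simp] theorem lift_tmul (f : M →+ N →+ P)
    (h : ∀ (r : R) (m : M) (n : N), f (op r • m) n = f m (r • n)) (m : M) (n : N) :
    lift f h (tmul R m n) = f m n := rfl

theorem hom_ext {f g : BalTensor R M N →+ P} (h : ∀ m n, f (tmul R m n) = g (tmul R m n)) :
    f = g := by
  ext x
  induction x using induction_on with
  | zero => simp
  | tmul m n => exact h m n
  | add x y hx hy => simp [hx, hy]

/-- `m ↦ m ⊗ n` and `n ↦ m ⊗ n`, as a biadditive map. -/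
def mk (R M N : Type*) [Ring R] [AddCommGroup M] [Module Rᵐᵒᵖ M]
    [AddCommGroup N] [Module R N] : M →+ N →+ BalTensor R M N :=
  AddMonoidHom.mk' (fun m => AddMonoidHom.mk' (fun n => tmul R m n) (tmul_add m))
    (fun m m' => by ext n; exact add_tmul m m' n)

@[simp] theorem mk_apply (m : M) (n : N) : mk R M N m n = tmul R m n := rfl

/-- The tensor product `f ⊗_R g` of a right linear map and a left linear map. -/
def map (f : M →ₗ[Rᵐᵒᵖ] M') (g : N →ₗ[R] N') : BalTensor R M N →+ BalTensor R M' N' :=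
  lift (((mk R M' N').comp f.toAddMonoidHom).compr₂ (AddMonoidHom.id _) |>.compl₂ g.toAddMonoidHom)
    (fun r m n => by simp [smul_tmul])

@[simp] theorem map_tmul (f : M →ₗ[Rᵐᵒᵖ] M') (g : N →ₗ[R] N') (m : M) (n : N) :
    map f g (tmul R m n) = tmul R (f m) (g n) := rfl

theorem map_map (f : M →ₗ[Rᵐᵒᵖ] M') (g : N →ₗ[R] N') (f' : M' →ₗ[Rᵐᵒᵖ] M'')
    (g' : N' →ₗ[R] N'') (x : BalTensor R M N) :
    map f' g' (map f g x) = map (f' ∘ₗ f) (g' ∘ₗ g) x := by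
  induction x using induction_on with
  | zero => simp
  | tmul m n => simp
  | add x y hx hy => simp [hx, hy]

@[simp] theorem map_id (x : BalTensor R M N) :
    map (LinearMap.id : M →ₗ[Rᵐᵒᵖ] M) (LinearMap.id : N →ₗ[R] N) x = x := by
  induction x using induction_on with
  | zero => simp
  | tmul m n => simp
  | add x y hx hy => simp [hx, hy]

end Basic

section Actions

variable {R : Type*} {M M' : Type*} {N N' : Type*} [Ring R]
  [AddCommGroup M] [Module Rᵐᵒᵖ M] [AddCommGroup N] [Module R N]
  [AddCommGroup M'] [Module Rᵐᵒᵖ M'] [AddCommGroup N'] [Module R N']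

/-- A left action on `M` that commutes with the right `R`-action, as right linear maps. -/
def leftMul {S : Type*} [Ring S] [Module S M] [SMulCommClass S Rᵐᵒᵖ M] (s : S) :
    M →ₗ[Rᵐᵒᵖ] M :=
  linOf (DistribSMul.toAddMonoidHom M s) (fun r m => smul_comm s r m)

@[simp] theorem leftMul_apply {S : Type*} [Ring S] [Module S M] [SMulCommClass S Rᵐᵒᵖ M] (s : S)
    (m : M) : leftMul (R := R) s m = s • m := rfl

/-- A right action on `N` that commutes with the left `R`-action, as left linear maps. -/
def rightMul {S : Type*} [Ring S] [Module Sᵐᵒᵖ N] [SMulCommClass R Sᵐᵒᵖ N] (s : Sᵐᵒᵖ) :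
    N →ₗ[R] N :=
  linOf (DistribSMul.toAddMonoidHom N s) (fun r n => (smul_comm r s n).symm)

@[simp] theorem rightMul_apply {S : Type*} [Ring S] [Module Sᵐᵒᵖ N] [SMulCommClass R Sᵐᵒᵖ N]
    (s : Sᵐᵒᵖ) (n : N) : rightMul (R := R) s n = s • n := rfl

/-- For an `S`-`R` bimodule `M`, the left `S`-action `s (m ⊗ n) = (s m) ⊗ n`. -/
instance leftModule {S : Type*} [Ring S] [Module S M] [SMulCommClass S Rᵐᵒᵖ M] :
    Module S (BalTensor R M N) where
  smul s x := map (leftMul s) LinearMap.id x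
  one_smul x := by
    change map (leftMul (1 : S)) LinearMap.id x = x
    induction x using induction_on with
    | zero => simp
    | tmul m n => simp
    | add x y hx hy => simp [hx, hy]
  mul_smul s t x := by
    change map (leftMul (s * t)) LinearMap.id x =
      map (leftMul s) LinearMap.id (map (leftMul t) LinearMap.id x)
    induction x using induction_on with
    | zero => simp
    | tmul m n => simp [mul_smul]
    | add x y hx hy => simp [hx, hy]
  smul_zero s := by
    change map (leftMul s) LinearMap.id 0 = 0
    simp
  smul_add s x y := by
    change map (leftMul s) LinearMap.id (x + y) =
      map (leftMul s) LinearMap.id x + map (leftMul s) LinearMap.id y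
    simp
  add_smul s t x := by
    change map (leftMul (s + t)) LinearMap.id x =
      map (leftMul s) LinearMap.id x + map (leftMul t) LinearMap.id x
    induction x using induction_on with
    | zero => simp
    | tmul m n => simp [add_smul, add_tmul]
    | add x y hx hy => simp only [map_add, hx, hy]; abel
  zero_smul x := by
    change map (leftMul (0 : S)) LinearMap.id x = 0
    induction x using induction_on with
    | zero => simp
    | tmul m n => simp
    | add x y hx hy => simp [hx, hy]

theorem left_smul_tmul {S : Type*} [Ring S] [Module S M] [SMulCommClass S Rᵐᵒᵖ M] (s : S)
    (m : M) (n : N) : s • tmul R m n = tmul R (s • m) n := rfl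

/-- For an `R`-`S` bimodule `N`, the right `S`-action `(m ⊗ n) s = m ⊗ (n s)`. -/
instance rightModule {S : Type*} [Ring S] [Module Sᵐᵒᵖ N] [SMulCommClass R Sᵐᵒᵖ N] :
    Module Sᵐᵒᵖ (BalTensor R M N) where
  smul s x := map LinearMap.id (rightMul s) x
  one_smul x := by
    change map LinearMap.id (rightMul (1 : Sᵐᵒᵖ)) x = x
    induction x using induction_on with
    | zero => simp
    | tmul m n => simp
    | add x y hx hy => simp [hx, hy]
  mul_smul s t x := by
    change map LinearMap.id (rightMul (s * t)) x =
      map LinearMap.id (rightMul s) (map LinearMap.id (rightMul t) x)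
    induction x using induction_on with
    | zero => simp
    | tmul m n => simp [mul_smul]
    | add x y hx hy => simp [hx, hy]
  smul_zero s := by
    change map LinearMap.id (rightMul s) 0 = 0
    simp
  smul_add s x y := by
    change map LinearMap.id (rightMul s) (x + y) =
      map LinearMap.id (rightMul s) x + map LinearMap.id (rightMul s) y
    simp
  add_smul s t x := by
    change map LinearMap.id (rightMul (s + t)) x =
      map LinearMap.id (rightMul s) x + map LinearMap.id (rightMul t) x
    induction x using induction_on with
    | zero => simp
    | tmul m n => simp [add_smul, tmul_add]
    | add x y hx hy => simp only [map_add, hx, hy]; abel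
  zero_smul x := by
    change map LinearMap.id (rightMul (0 : Sᵐᵒᵖ)) x = 0
    induction x using induction_on with
    | zero => simp
    | tmul m n => simp
    | add x y hx hy => simp [hx, hy]

theorem right_smul_tmul {S : Type*} [Ring S] [Module Sᵐᵒᵖ N] [SMulCommClass R Sᵐᵒᵖ N]
    (s : S) (m : M) (n : N) : op s • tmul R m n = tmul R m (op s • n) := rfl

theorem op_smul_tmul {S : Type*} [Ring S] [Module Sᵐᵒᵖ N] [SMulCommClass R Sᵐᵒᵖ N]
    (s : Sᵐᵒᵖ) (m : M) (n : N) : s • tmul R m n = tmul R m (s • n) := rfl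

instance bimodule {S S' : Type*} [Ring S] [Module S M] [SMulCommClass S Rᵐᵒᵖ M] [Ring S']
    [Module S'ᵐᵒᵖ N] [SMulCommClass R S'ᵐᵒᵖ N] : SMulCommClass S S'ᵐᵒᵖ (BalTensor R M N) where
  smul_comm s s' x := by
    induction x using induction_on with
    | zero => simp only [smul_zero]
    | tmul m n => rfl
    | add x y hx hy => simp only [smul_add, hx, hy]

/-- `f ⊗_R g` is left linear when `f` is. -/
theorem map_left_smul {S : Type*} [Ring S] [Module S M] [SMulCommClass S Rᵐᵒᵖ M]
    [Module S M'] [SMulCommClass S Rᵐᵒᵖ M'] (f : M →ₗ[Rᵐᵒᵖ] M') (g : N →ₗ[R] N')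
    (hf : ∀ (s : S) m, f (s • m) = s • f m) (s : S) (x : BalTensor R M N) :
    map f g (s • x) = s • map f g x := by
  induction x using induction_on with
  | zero => simp only [smul_zero, map_zero]
  | tmul m n => simp only [left_smul_tmul, map_tmul, hf]
  | add x y hx hy => simp only [smul_add, map_add, hx, hy]

/-- `f ⊗_R g` is right linear when `g` is. -/
theorem map_right_smul {S : Type*} [Ring S] [Module Sᵐᵒᵖ N] [SMulCommClass R Sᵐᵒᵖ N]
    [Module Sᵐᵒᵖ N'] [SMulCommClass R Sᵐᵒᵖ N'] (f : M →ₗ[Rᵐᵒᵖ] M') (g : N →ₗ[R] N')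
    (hg : ∀ (s : Sᵐᵒᵖ) n, g (s • n) = s • g n) (s : Sᵐᵒᵖ) (x : BalTensor R M N) :
    map f g (s • x) = s • map f g x := by
  induction x using induction_on with
  | zero => simp only [smul_zero, map_zero]
  | tmul m n => simp only [op_smul_tmul, map_tmul, hg]
  | add x y hx hy => simp only [smul_add, map_add, hx, hy]

/-- The isomorphism `R ⊗_R N → N`, `r ⊗ n ↦ r n`. -/
def lid (R N : Type*) [Ring R] [AddCommGroup N] [Module R N] : BalTensor R R N →+ N :=
  lift (AddMonoidHom.mk' (fun r => DistribSMul.toAddMonoidHom N r)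
      (fun r s => by ext n; exact add_smul r s n))
    (fun r s n => mul_smul s r n)

@[simp] theorem lid_tmul (r : R) (n : N) : lid R N (tmul R r n) = r • n := rfl

/-- The isomorphism `M ⊗_R R → M`, `m ⊗ r ↦ m r`. -/
def rid (R M : Type*) [Ring R] [AddCommGroup M] [Module Rᵐᵒᵖ M] : BalTensor R M R →+ M :=
  lift (AddMonoidHom.mk' (fun m => AddMonoidHom.mk' (fun r : R => op r • m)
      (fun r s => by rw [op_add, add_smul]))
      (fun m m' => by ext r; exact smul_add (op r) m m'))
    (fun r m s => by simp [mul_smul])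

@[simp] theorem rid_tmul (m : M) (r : R) : rid R M (tmul R m r) = op r • m := rfl

end Actions

section Assoc

variable {R S : Type*} {M N P : Type*} [Ring R] [Ring S]
  [AddCommGroup M] [Module Rᵐᵒᵖ M] [AddCommGroup N] [Module R N] [Module Sᵐᵒᵖ N]
  [SMulCommClass R Sᵐᵒᵖ N] [AddCommGroup P] [Module S P]

/-- The map `(M ⊗_R N) ⊗_S P → M ⊗_R (N ⊗_S P)`, `(m ⊗ n) ⊗ p ↦ m ⊗ (n ⊗ p)`. -/
def assocHom : BalTensor S (BalTensor R M N) P →+ BalTensor R M (BalTensor S N P) :=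
  lift
    (lift (AddMonoidHom.mk' (fun m => (mk S N P).compr₂ (mk R M (BalTensor S N P) m))
        (fun m m' => by ext n p; exact add_tmul m m' (tmul S n p)))
      (fun r m n => by ext p; exact smul_tmul r m (tmul S n p)))
    (fun s x p => by
      induction x using induction_on with
      | zero => simp
      | tmul m n =>
        change tmul R m (tmul S (op s • n) p) = tmul R m (tmul S n (s • p))
        rw [smul_tmul]
      | add x y hx hy => simp only [smul_add, map_add, AddMonoidHom.add_apply, hx, hy])

/-- The map `M ⊗_R (N ⊗_S P) → (M ⊗_R N) ⊗_S P`, `m ⊗ (n ⊗ p) ↦ (m ⊗ n) ⊗ p`. -/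
def assocInv : BalTensor R M (BalTensor S N P) →+ BalTensor S (BalTensor R M N) P :=
  lift
    (AddMonoidHom.mk' (fun m => lift ((mk S (BalTensor R M N) P).comp (mk R M N m))
        (fun s n p => smul_tmul s (tmul R m n) p))
      (fun m m' => hom_ext (fun n p => by
        change tmul S (tmul R (m + m') n) p = tmul S (tmul R m n) p + tmul S (tmul R m' n) p
        rw [add_tmul, add_tmul])))
    (fun r m x => by
      induction x using induction_on with
      | zero => simp
      | tmul n p =>
        change tmul S (tmul R (op r • m) n) p = tmul S (tmul R m (r • n)) p
        rw [smul_tmul]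
      | add x y hx hy => simp only [smul_add, map_add, hx, hy])

@[simp] theorem assocHom_tmul (m : M) (n : N) (p : P) :
    assocHom (tmul S (tmul R m n) p) = tmul R m (tmul S n p) := rfl

@[simp] theorem assocInv_tmul (m : M) (n : N) (p : P) :
    assocInv (tmul R m (tmul S n p)) = tmul S (tmul R m n) p := rfl

/-- The associativity isomorphism `(M ⊗_R N) ⊗_S P ≅ M ⊗_R (N ⊗_S P)`. -/
def assoc (R S M N P : Type*) [Ring R] [Ring S]
    [AddCommGroup M] [Module Rᵐᵒᵖ M] [AddCommGroup N] [Module R N] [Module Sᵐᵒᵖ N]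
    [SMulCommClass R Sᵐᵒᵖ N] [AddCommGroup P] [Module S P] :
    BalTensor S (BalTensor R M N) P ≃+ BalTensor R M (BalTensor S N P) :=
  AddMonoidHom.toAddEquiv assocHom assocInv
    (hom_ext (fun x p => by
      induction x using induction_on with
      | zero => simp
      | tmul m n => rfl
      | add x y hx hy => simp only [add_tmul, map_add, hx, hy]))
    (hom_ext (fun m x => by
      induction x using induction_on with
      | zero => simp
      | tmul n p => rfl
      | add x y hx hy => simp only [tmul_add, map_add, hx, hy]))

@[simp] theorem assoc_tmul (m : M) (n : N) (p : P) :
    assoc R S M N P (tmul S (tmul R m n) p) = tmul R m (tmul S n p) := rfl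

@[simp] theorem assoc_symm_tmul (m : M) (n : N) (p : P) :
    (assoc R S M N P).symm (tmul R m (tmul S n p)) = tmul S (tmul R m n) p := rfl

/-- `f ⊗_R N`, as a right linear map, for a bimodule `N`. -/
def rTensorOp {M' : Type*} [AddCommGroup M'] [Module Rᵐᵒᵖ M'] (f : M →ₗ[Rᵐᵒᵖ] M') :
    BalTensor R M N →ₗ[Sᵐᵒᵖ] BalTensor R M' N :=
  linOf (map f LinearMap.id) (map_right_smul f LinearMap.id (fun _ _ => rfl))

theorem assoc_rTensorOp {M' : Type*} [AddCommGroup M'] [Module Rᵐᵒᵖ M'] (f : M →ₗ[Rᵐᵒᵖ] M')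
    (z : BalTensor S (BalTensor R M N) P) :
    assoc R S M' N P (map (rTensorOp f) LinearMap.id z) =
      map f LinearMap.id (assoc R S M N P z) := by
  induction z using induction_on with
  | zero => simp
  | tmul x p =>
    induction x using induction_on with
    | zero => simp
    | tmul m n => rfl
    | add x y hx hy => simp only [add_tmul, map_add, hx, hy]
  | add x y hx hy => simp only [map_add, hx, hy]

theorem rid_map_map {Q : Type*} [AddCommGroup Q] [Module Rᵐᵒᵖ Q] {K : Type*} [AddCommGroup K]
    [Module R K] (f : M →ₗ[Rᵐᵒᵖ] Q) (g : K →ₗ[R] R) (z : BalTensor R M K) :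
    rid R Q (map LinearMap.id g (map f LinearMap.id z)) = f (rid R M (map LinearMap.id g z)) := by
  induction z using induction_on with
  | zero => simp
  | tmul m c => simp
  | add x y hx hy => simp only [map_add, hx, hy]

end Assoc

end BalTensor

open BalTensor

/-- An `A`-coring: a comonoid in the category of `A`-`A` bimodules. -/
class Coring (A : Type*) (C : Type*) [Ring A] [AddCommGroup C] [Module A C] [Module Aᵐᵒᵖ C]
    [SMulCommClass A Aᵐᵒᵖ C] where
  /-- the coproduct `Δ : C → C ⊗_A C` -/
  comul : C →+ BalTensor A C C
  comul_smul : ∀ (a : A) (c : C), comul (a • c) = a • comul c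
  comul_op_smul : ∀ (a : Aᵐᵒᵖ) (c : C), comul (a • c) = a • comul c
  /-- the counit `ε : C → A` -/
  counit : C →+ A
  counit_smul : ∀ (a : A) (c : C), counit (a • c) = a • counit c
  counit_op_smul : ∀ (a : Aᵐᵒᵖ) (c : C), counit (a • c) = a • counit c
  coassoc : ∀ c : C, assoc A A C C C
      (BalTensor.map (linOf comul comul_op_smul) LinearMap.id (comul c)) =
    BalTensor.map LinearMap.id (linOf comul comul_smul) (comul c)
  counit_comul : ∀ c : C,
    lid A C (BalTensor.map (linOf counit counit_op_smul) LinearMap.id (comul c)) = c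
  comul_counit : ∀ c : C,
    rid A C (BalTensor.map LinearMap.id (linOf counit counit_smul) (comul c)) = c

section Comodules

variable (A : Type*) (C : Type*) [Ring A] [AddCommGroup C] [Module A C] [Module Aᵐᵒᵖ C]
  [SMulCommClass A Aᵐᵒᵖ C] [Coring A C]

/-- The coproduct as a left linear map. -/
def comulL : C →ₗ[A] BalTensor A C C := linOf Coring.comul Coring.comul_smul

/-- The coproduct as a right linear map. -/
def comulR : C →ₗ[Aᵐᵒᵖ] BalTensor A C C := linOf Coring.comul Coring.comul_op_smul

/-- The counit as a left linear map. -/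
def counitL : C →ₗ[A] A := linOf Coring.counit Coring.counit_smul

/-- The counit as a right linear map. -/
def counitR : C →ₗ[Aᵐᵒᵖ] A := linOf Coring.counit Coring.counit_op_smul

/-- A right comodule over the `A`-coring `C`: a right `A`-module `M` with a right `A`-linear,
coassociative and counital coaction `M → M ⊗_A C`. -/
class RightComodule (M : Type*) [AddCommGroup M] [Module Aᵐᵒᵖ M] where
  /-- the coaction -/
  coact : M →ₗ[Aᵐᵒᵖ] BalTensor A M C
  coact_coassoc : ∀ m : M, assoc A A M C C (BalTensor.map coact LinearMap.id (coact m)) =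
    BalTensor.map LinearMap.id (comulL A C) (coact m)
  coact_counit : ∀ m : M, rid A M (BalTensor.map LinearMap.id (counitL A C) (coact m)) = m

/-- The coaction of a right `C`-comodule. -/
def coact (M : Type*) [AddCommGroup M] [Module Aᵐᵒᵖ M] [RightComodule A C M] :
    M →ₗ[Aᵐᵒᵖ] BalTensor A M C := RightComodule.coact

/-- A right `A`-linear map between right `C`-comodules is colinear if it commutes with the
coactions. -/
def IsColinear {M N : Type*} [AddCommGroup M] [Module Aᵐᵒᵖ M] [RightComodule A C M]
    [AddCommGroup N] [Module Aᵐᵒᵖ N] [RightComodule A C N] (f : M →ₗ[Aᵐᵒᵖ] N) : Prop :=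
  ∀ m : M, coact A C N (f m) = BalTensor.map f LinearMap.id (coact A C M m)

/-- The right regular comodule. -/
instance regularComodule : RightComodule A C C where
  coact := comulR A C
  coact_coassoc := Coring.coassoc
  coact_counit := Coring.comul_counit

section

variable {A C}
variable {M : Type*} [AddCommGroup M] [Module Aᵐᵒᵖ M] [RightComodule A C M]

/-- For a left `A`-linear map `φ : C → A`, the map `M → M`, `m ↦ m^{[0]} φ(m^{[1]})`. -/
def coactEval (φ : C →ₗ[A] A) : M →+ M :=
  (rid A M).comp ((BalTensor.map LinearMap.id φ).comp (coact A C M).toAddMonoidHom)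

theorem coactEval_apply (φ : C →ₗ[A] A) (m : M) :
    coactEval φ m = rid A M (BalTensor.map LinearMap.id φ (coact A C M m)) := rfl

theorem rid_left_smul {S : Type*} [Ring S] {N : Type*} [AddCommGroup N] [Module Aᵐᵒᵖ N]
    [Module S N] [SMulCommClass S Aᵐᵒᵖ N] (s : S) (x : BalTensor A N A) :
    rid A N (s • x) = s • rid A N x := by
  induction x using BalTensor.induction_on with
  | zero => simp only [smul_zero, map_zero]
  | tmul n a => simp only [left_smul_tmul, rid_tmul, smul_comm]
  | add x y hx hy => simp only [smul_add, map_add, hx, hy]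

/-- The map `C → C`, `c ↦ c^{(1)} φ(c^{(2)})`, as a left linear map. -/
def comulEval (φ : C →ₗ[A] A) : C →ₗ[A] C :=
  linOf (coactEval φ) (fun a c => by
    have h : coact A C C (a • c) = a • coact A C C c := Coring.comul_smul a c
    rw [coactEval_apply, h, BalTensor.map_left_smul _ _ (fun _ _ => rfl), rid_left_smul]
    rfl)

theorem coact_coactEval (φ : C →ₗ[A] A) (m : M) :
    coact A C M (coactEval φ m) =
      BalTensor.map LinearMap.id (comulEval φ) (coact A C M m) := by
  have key : ∀ y : BalTensor A M C,
      coact A C M (rid A M (BalTensor.map LinearMap.id φ y)) =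
        BalTensor.map LinearMap.id (linOf ((rid A C).comp (BalTensor.map LinearMap.id φ))
          (fun a x => by
            change rid A C (BalTensor.map LinearMap.id φ (a • x)) = _
            rw [BalTensor.map_left_smul _ _ (fun _ _ => rfl), rid_left_smul]
            rfl)) (assoc A A M C C (BalTensor.map (coact A C M) LinearMap.id y)) := by
    intro y
    induction y using BalTensor.induction_on with
    | zero => simp
    | tmul m c =>
      simp only [BalTensor.map_tmul, LinearMap.id_apply, rid_tmul, map_smul]
      generalize coact A C M m = z
      induction z using BalTensor.induction_on with
      | zero => simp
      | tmul m' c' => rfl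
      | add x y hx hy => simp only [smul_add, map_add, BalTensor.add_tmul, hx, hy]
    | add x y hx hy => simp only [map_add, hx, hy]
  rw [coactEval_apply, key]
  have h := RightComodule.coact_coassoc (A := A) (C := C) m
  change assoc A A M C C (BalTensor.map (coact A C M) LinearMap.id (coact A C M m)) =
    BalTensor.map LinearMap.id (comulL A C) (coact A C M m) at h
  rw [h, BalTensor.map_map]
  rfl

end

/-- The map `N ⊗_A Δ : N ⊗_A C → (N ⊗_A C) ⊗_A C`. -/
def freeCoact (N : Type*) [AddCommGroup N] [Module Aᵐᵒᵖ N] :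
    BalTensor A N C →ₗ[Aᵐᵒᵖ] BalTensor A (BalTensor A N C) C :=
  linOf ((assoc A A N C C).symm.toAddMonoidHom.comp
      (BalTensor.map LinearMap.id (comulL A C))) (fun a x => by
    induction x using BalTensor.induction_on with
    | zero => simp
    | tmul n c =>
      have h : comulL A C (a • c) = a • comulL A C c := Coring.comul_op_smul a c
      simp only [op_smul_tmul, AddMonoidHom.comp_apply, BalTensor.map_tmul, h]
      generalize comulL A C c = z
      induction z using BalTensor.induction_on with
      | zero => simp
      | tmul c c' => rfl
      | add x y hx hy => simp only [smul_add, BalTensor.tmul_add, map_add, hx, hy]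
    | add x y hx hy => simp only [smul_add, map_add, hx, hy])

/-- For a right `A`-module `N`, the right `C`-comodule `N ⊗_A C` with coaction `N ⊗_A Δ`. -/
instance freeComodule (N : Type*) [AddCommGroup N] [Module Aᵐᵒᵖ N] :
    RightComodule A C (BalTensor A N C) where
  coact := freeCoact A C N
  coact_coassoc x := by
    induction x using BalTensor.induction_on with
    | zero => simp
    | tmul n c =>
      have h1 : ∀ z : BalTensor A C C,
          assoc A A (BalTensor A N C) C C (BalTensor.map (freeCoact A C N) LinearMap.id
              ((assoc A A N C C).symm (tmul A n z))) =
          (assoc A A N C (BalTensor A C C)).symm (tmul A n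
            (assoc A A C C C (BalTensor.map (comulR A C) LinearMap.id z))) := by
        intro z
        induction z using BalTensor.induction_on with
        | zero => simp
        | tmul c c' =>
          change assoc A A (BalTensor A N C) C C
            (tmul A ((assoc A A N C C).symm (tmul A n (comulR A C c))) c') = _
          simp only [BalTensor.map_tmul]
          generalize comulR A C c = z
          induction z using BalTensor.induction_on with
          | zero => simp
          | tmul c c' => rfl
          | add x y hx hy =>
            simp only [BalTensor.add_tmul, BalTensor.tmul_add, map_add, hx, hy]
        | add x y hx hy => simp only [BalTensor.tmul_add, map_add, hx, hy]
      have h2 : ∀ z : BalTensor A C C,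
          BalTensor.map LinearMap.id (comulL A C) ((assoc A A N C C).symm (tmul A n z)) =
          (assoc A A N C (BalTensor A C C)).symm (tmul A n
            (BalTensor.map LinearMap.id (comulL A C) z)) := by
        intro z
        induction z using BalTensor.induction_on with
        | zero => simp
        | tmul c c' => rfl
        | add x y hx hy => simp only [BalTensor.tmul_add, map_add, hx, hy]
      refine (h1 (comulL A C c)).trans (Eq.trans ?_ (h2 (comulL A C c)).symm)
      exact congrArg (fun z => (assoc A A N C (BalTensor A C C)).symm (tmul A n z))
        (Coring.coassoc c)
    | add x y hx hy => simp only [map_add, hx, hy]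
  coact_counit x := by
    induction x using BalTensor.induction_on with
    | zero => simp
    | tmul n c =>
      have h : ∀ z : BalTensor A C C, rid A (BalTensor A N C)
          (BalTensor.map LinearMap.id (counitL A C) ((assoc A A N C C).symm (tmul A n z))) =
          tmul A n (rid A C (BalTensor.map LinearMap.id (counitL A C) z)) := by
        intro z
        induction z using BalTensor.induction_on with
        | zero => simp
        | tmul c c' => rfl
        | add x y hx hy => simp only [BalTensor.tmul_add, map_add, hx, hy]
      refine (h (comulL A C c)).trans ?_
      exact congrArg (fun z => tmul A n z) (Coring.comul_counit c)
    | add x y hx hy => simp only [map_add, hx, hy]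

/-- The coaction of a direct sum: `(m, n) ↦ m^{[0]} ⊗ m^{[1]} + n^{[0]} ⊗ n^{[1]}`. -/
def prodCoact (M N : Type*) [AddCommGroup M] [Module Aᵐᵒᵖ M] [RightComodule A C M]
    [AddCommGroup N] [Module Aᵐᵒᵖ N] [RightComodule A C N] :
    M × N →ₗ[Aᵐᵒᵖ] BalTensor A (M × N) C :=
  LinearMap.coprod
    (rTensorOp (LinearMap.inl Aᵐᵒᵖ M N) ∘ₗ coact A C M)
    (rTensorOp (LinearMap.inr Aᵐᵒᵖ M N) ∘ₗ coact A C N)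

theorem coact_coassoc' {M : Type*} [AddCommGroup M] [Module Aᵐᵒᵖ M] [RightComodule A C M] (m : M) :
    assoc A A M C C (BalTensor.map (coact A C M) LinearMap.id (coact A C M m)) =
      BalTensor.map LinearMap.id (comulL A C) (coact A C M m) :=
  RightComodule.coact_coassoc m

theorem coact_counit' {M : Type*} [AddCommGroup M] [Module Aᵐᵒᵖ M] [RightComodule A C M] (m : M) :
    rid A M (BalTensor.map LinearMap.id (counitL A C) (coact A C M m)) = m :=
  RightComodule.coact_counit m

/-- The direct sum of two right comodules. -/
instance prodComodule (M N : Type*) [AddCommGroup M] [Module Aᵐᵒᵖ M] [RightComodule A C M]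
    [AddCommGroup N] [Module Aᵐᵒᵖ N] [RightComodule A C N] : RightComodule A C (M × N) where
  coact := prodCoact A C M N
  coact_coassoc x := by
    have hl : prodCoact A C M N ∘ₗ LinearMap.inl Aᵐᵒᵖ M N =
        rTensorOp (LinearMap.inl Aᵐᵒᵖ M N) ∘ₗ coact A C M := LinearMap.coprod_inl _ _
    have hr : prodCoact A C M N ∘ₗ LinearMap.inr Aᵐᵒᵖ M N =
        rTensorOp (LinearMap.inr Aᵐᵒᵖ M N) ∘ₗ coact A C N := LinearMap.coprod_inr _ _
    have h1 : assoc A A (M × N) C C (BalTensor.map (prodCoact A C M N) LinearMap.id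
        (BalTensor.map (LinearMap.inl Aᵐᵒᵖ M N) LinearMap.id (coact A C M x.1))) =
        BalTensor.map LinearMap.id (comulL A C)
          (BalTensor.map (LinearMap.inl Aᵐᵒᵖ M N) LinearMap.id (coact A C M x.1)) := by
      rw [BalTensor.map_map, hl, ← BalTensor.map_map (coact A C M) LinearMap.id,
        assoc_rTensorOp, coact_coassoc', BalTensor.map_map, BalTensor.map_map]
      rfl
    have h2 : assoc A A (M × N) C C (BalTensor.map (prodCoact A C M N) LinearMap.id
        (BalTensor.map (LinearMap.inr Aᵐᵒᵖ M N) LinearMap.id (coact A C N x.2))) =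
        BalTensor.map LinearMap.id (comulL A C)
          (BalTensor.map (LinearMap.inr Aᵐᵒᵖ M N) LinearMap.id (coact A C N x.2)) := by
      rw [BalTensor.map_map, hr, ← BalTensor.map_map (coact A C N) LinearMap.id,
        assoc_rTensorOp, coact_coassoc', BalTensor.map_map, BalTensor.map_map]
      rfl
    have hx : prodCoact A C M N x =
        BalTensor.map (LinearMap.inl Aᵐᵒᵖ M N) LinearMap.id (coact A C M x.1) +
        BalTensor.map (LinearMap.inr Aᵐᵒᵖ M N) LinearMap.id (coact A C N x.2) := rfl
    rw [hx, map_add, map_add, map_add, h1, h2]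
  coact_counit x := by
    have hx : prodCoact A C M N x =
        BalTensor.map (LinearMap.inl Aᵐᵒᵖ M N) LinearMap.id (coact A C M x.1) +
        BalTensor.map (LinearMap.inr Aᵐᵒᵖ M N) LinearMap.id (coact A C N x.2) := rfl
    rw [hx, map_add, map_add, rid_map_map, rid_map_map, coact_counit', coact_counit']
    simp

/-- The algebra `End^C(M)` of endomorphisms of a right `C`-comodule, as a ring under
composition. -/
def comodEnd (M : Type*) [AddCommGroup M] [Module Aᵐᵒᵖ M] [RightComodule A C M] :
    Subring (Module.End Aᵐᵒᵖ M) where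
  carrier := {f | IsColinear A C f}
  mul_mem' {f g} hf hg m := by
    change coact A C M (f (g m)) = _
    rw [hf, hg, BalTensor.map_map]
    rfl
  one_mem' m := (BalTensor.map_id _).symm
  add_mem' {f g} hf hg m := by
    change coact A C M (f m + g m) = _
    rw [map_add, hf, hg]
    generalize coact A C M m = z
    induction z using BalTensor.induction_on with
    | zero => simp
    | tmul m c => simp [BalTensor.add_tmul]
    | add x y hx hy => simp only [map_add, ← hx, ← hy]; abel
  zero_mem' m := by
    change coact A C M 0 = _
    rw [map_zero]
    generalize coact A C M m = z
    induction z using BalTensor.induction_on with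
    | zero => simp
    | tmul m c => simp
    | add x y hx hy => simp only [map_add, ← hx, ← hy, add_zero]
  neg_mem' {f} hf m := by
    change coact A C M (- f m) = _
    rw [map_neg, hf]
    generalize coact A C M m = z
    induction z using BalTensor.induction_on with
    | zero => simp
    | tmul m c =>
      rw [eq_comm, eq_neg_iff_add_eq_zero]
      simp [← BalTensor.add_tmul]
    | add x y hx hy => simp only [map_add, ← hx, ← hy]; abel

/-- `Hom_A(M, N)` is a right module over `End^C(M)`, by composition. -/
instance homRightModule (M N : Type*) [AddCommGroup M] [Module Aᵐᵒᵖ M] [RightComodule A C M]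
    [AddCommGroup N] [Module Aᵐᵒᵖ N] : Module (comodEnd A C M)ᵐᵒᵖ (M →ₗ[Aᵐᵒᵖ] N) where
  smul t φ := φ ∘ₗ (t.unop : Module.End Aᵐᵒᵖ M)
  one_smul φ := rfl
  mul_smul s t φ := rfl
  smul_zero t := rfl
  smul_add t φ ψ := rfl
  add_smul s t φ := by
    ext x
    exact map_add φ _ _
  zero_smul φ := by
    ext x
    exact map_zero φ

/-- The canonical map `can_N : Hom_A(M, N) ⊗_T M → N ⊗_A C`,
`φ ⊗ x ↦ φ(x^{[0]}) ⊗ x^{[1]}`, for `T = End^C(M)` and a right `A`-module `N`. -/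
def canMap (M : Type*) [AddCommGroup M] [Module Aᵐᵒᵖ M] [RightComodule A C M]
    (N : Type*) [AddCommGroup N] [Module Aᵐᵒᵖ N] :
    BalTensor (comodEnd A C M) (M →ₗ[Aᵐᵒᵖ] N) M →+ BalTensor A N C :=
  BalTensor.lift
    (AddMonoidHom.mk' (fun φ => (BalTensor.map φ LinearMap.id).comp (coact A C M).toAddMonoidHom)
      (fun φ ψ => by
        ext x
        change BalTensor.map (φ + ψ) LinearMap.id (coact A C M x) =
          BalTensor.map φ LinearMap.id (coact A C M x) +
            BalTensor.map ψ LinearMap.id (coact A C M x)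
        generalize coact A C M x = z
        induction z using BalTensor.induction_on with
        | zero => simp
        | tmul m c => simp [BalTensor.add_tmul]
        | add x y hx hy => simp only [map_add, hx, hy]; abel))
    (fun t φ x => by
      change BalTensor.map (φ ∘ₗ (t : Module.End Aᵐᵒᵖ M)) LinearMap.id (coact A C M x) =
        BalTensor.map φ LinearMap.id (coact A C M ((t : Module.End Aᵐᵒᵖ M) x))
      rw [t.2 x, BalTensor.map_map]
      rfl)

/-- A right `C`-comodule `M` is a Galois comodule if the natural transformation
`can_N : Hom_A(M, N) ⊗_T M → N ⊗_A C`, for right `A`-modules `N`, is an isomorphism. -/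
def IsGaloisComodule (M : Type u) [AddCommGroup M] [Module Aᵐᵒᵖ M] [RightComodule A C M] : Prop :=
  ∀ (N : Type u) [AddCommGroup N] [Module Aᵐᵒᵖ N], Function.Bijective (canMap A C M N)

/-- A left `S`-module and right `C`-comodule with commuting actions is an `S`-`C` bicomodule
if its coaction is left `S`-linear. -/
class IsBicomodule (S : Type*) (A : Type*) (C : Type*) (M : Type*) [Ring S] [Ring A]
    [AddCommGroup C] [Module A C] [Module Aᵐᵒᵖ C] [SMulCommClass A Aᵐᵒᵖ C] [Coring A C]
    [AddCommGroup M] [Module Aᵐᵒᵖ M] [RightComodule A C M] [Module S M]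
    [SMulCommClass S Aᵐᵒᵖ M] : Prop where
  coact_smul : ∀ (s : S) (m : M), coact A C M (s • m) = s • coact A C M m

/-- Two objects, each a left `S`-module and a right `C`-comodule, are isomorphic if there is a
bijective left `S`-linear and right `C`-colinear (in particular right `A`-linear) map. -/
def BicomoduleIso (S : Type*) (A : Type*) (C : Type*) (M N : Type*) [Ring S] [Ring A]
    [AddCommGroup C] [Module A C] [Module Aᵐᵒᵖ C] [SMulCommClass A Aᵐᵒᵖ C] [Coring A C]
    [AddCommGroup M] [Module Aᵐᵒᵖ M] [RightComodule A C M] [Module S M]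
    [AddCommGroup N] [Module Aᵐᵒᵖ N] [RightComodule A C N] [Module S N] : Prop :=
  ∃ e : M ≃ₗ[Aᵐᵒᵖ] N, (∀ (s : S) (m : M), e (s • m) = s • e m) ∧ IsColinear A C e.toLinearMap

end Comodules

section Extensions

variable (A : Type*) (C : Type*) (L : Type*) (D : Type*)
  [Ring A] [AddCommGroup C] [Module A C] [Module Aᵐᵒᵖ C] [SMulCommClass A Aᵐᵒᵖ C] [Coring A C]
  [Ring L] [AddCommGroup D] [Module L D] [Module Lᵐᵒᵖ D] [SMulCommClass L Lᵐᵒᵖ D] [Coring L D]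
  [Module Lᵐᵒᵖ C] [SMulCommClass A Lᵐᵒᵖ C] [RightComodule L D C]

/-- The `L`-coring `D` is a right extension of the `A`-coring `C`: with the left regular
`C`-coaction and the given right `D`-coaction `τ`, `C` is a `C`-`D` bicomodule. That is, `τ` is
left `A`-linear and the coproduct of `C` is right `D`-colinear (in particular right `L`-linear),
where `C ⊗_A C` has the coaction `C ⊗_A τ`. -/
class IsRightCoringExtension : Prop where
  coact_smul : ∀ (a : A) (c : C), (coact L D C).toAddMonoidHom (a • c) =
    a • (coact L D C).toAddMonoidHom c
  comul_op_smul : ∀ (l : Lᵐᵒᵖ) (c : C),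
    (Coring.comul (l • c) : BalTensor A C C) = l • (Coring.comul c : BalTensor A C C)
  comul_colinear : ∀ c : C,
    assoc A L C C D (BalTensor.map (linOf (Coring.comul : C →+ BalTensor A C C)
        comul_op_smul) LinearMap.id (coact L D C c)) =
      BalTensor.map LinearMap.id (linOf (coact L D C).toAddMonoidHom coact_smul)
        (Coring.comul c : BalTensor A C C)

variable [IsRightCoringExtension A C L D]

/-- The right `D`-coaction of `C` as a left `A`-linear map. -/
def extCoactL : C →ₗ[A] BalTensor L C D :=
  linOf (coact L D C).toAddMonoidHom IsRightCoringExtension.coact_smul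

/-- The coproduct of `C` as a right `L`-linear map. -/
def extComulR : C →ₗ[Lᵐᵒᵖ] BalTensor A C C :=
  linOf (Coring.comul : C →+ BalTensor A C C)
    (IsRightCoringExtension.comul_op_smul (L := L) (D := D))

variable {A C} in
/-- The map `C → A`, `c ↦ ε(c l)`. -/
def twistedCounit {L : Type*} [Ring L] [Module Lᵐᵒᵖ C] [SMulCommClass A Lᵐᵒᵖ C] (l : Lᵐᵒᵖ) :
    C →ₗ[A] A :=
  counitL A C ∘ₗ rightMul l

/-- The right `L`-action `m l = m^{[0]} ε(m^{[1]} l)` on a right `C`-comodule. -/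
def extAct (M : Type*) [AddCommGroup M] [Module Aᵐᵒᵖ M] [RightComodule A C M] (l : Lᵐᵒᵖ) :
    M →+ M :=
  coactEval (twistedCounit (A := A) (C := C) l)

section

variable {A C L}

theorem comulEval_twistedCounit
    (h : ∀ (l : Lᵐᵒᵖ) (c : C), (Coring.comul (l • c) : BalTensor A C C) = l • Coring.comul c)
    (l : Lᵐᵒᵖ) :
    comulEval (twistedCounit (A := A) (C := C) l) = rightMul l := by
  ext c
  have h2 := Coring.comul_counit (A := A) (l • c)
  rw [h l c] at h2
  refine Eq.trans ?_ h2
  change rid A C (BalTensor.map LinearMap.id (counitL A C ∘ₗ rightMul l) (Coring.comul c)) = _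
  generalize (Coring.comul c : BalTensor A C C) = z
  induction z using BalTensor.induction_on with
  | zero => simp
  | tmul c c' => rfl
  | add x y hx hy => simp only [smul_add, map_add, hx, hy]

variable {M : Type*} [AddCommGroup M] [Module Aᵐᵒᵖ M] [RightComodule A C M]

theorem extAct_apply (l : Lᵐᵒᵖ) (m : M) : extAct A C L M l m =
    rid A M (BalTensor.map LinearMap.id (counitL A C ∘ₗ rightMul l) (coact A C M m)) := rfl

theorem coact_extAct
    (h : ∀ (l : Lᵐᵒᵖ) (c : C), (Coring.comul (l • c) : BalTensor A C C) = l • Coring.comul c)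
    (l : Lᵐᵒᵖ) (m : M) : coact A C M (extAct A C L M l m) = l • coact A C M m := by
  refine (coact_coactEval _ m).trans ?_
  rw [comulEval_twistedCounit h]
  rfl

theorem extAct_one (m : M) : extAct A C L M 1 m = m := by
  refine Eq.trans ?_ (coact_counit' A C (M := M) m)
  have h : counitL A C ∘ₗ rightMul (1 : Lᵐᵒᵖ) = counitL A C := by
    ext c
    simp
  rw [extAct_apply, h]

theorem extAct_mul
    (h : ∀ (l : Lᵐᵒᵖ) (c : C), (Coring.comul (l • c) : BalTensor A C C) = l • Coring.comul c)
    (l l' : Lᵐᵒᵖ) (m : M) :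
    extAct A C L M (l * l') m = extAct A C L M l (extAct A C L M l' m) := by
  rw [extAct_apply, extAct_apply, coact_extAct h]
  generalize coact A C M m = z
  induction z using BalTensor.induction_on with
  | zero => simp
  | tmul m c => simp [op_smul_tmul, mul_smul]
  | add x y hx hy => simp only [smul_add, map_add, hx, hy]

theorem extAct_add (l l' : Lᵐᵒᵖ) (m : M) :
    extAct A C L M (l + l') m = extAct A C L M l m + extAct A C L M l' m := by
  simp only [extAct_apply]
  generalize coact A C M m = z
  induction z using BalTensor.induction_on with
  | zero => simp
  | tmul m c => simp [add_smul]
  | add x y hx hy => simp only [map_add, hx, hy]; abel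

theorem extAct_zero (m : M) : extAct A C L M 0 m = 0 := by
  simp only [extAct_apply]
  generalize coact A C M m = z
  induction z using BalTensor.induction_on with
  | zero => simp
  | tmul m c => simp
  | add x y hx hy => simp only [map_add, hx, hy, add_zero]

end

/-- The underlying group of a right `C`-comodule `M`, regarded as a right `L`-module, and for a
pure extension as a right `D`-comodule, along the right coring extension `D` of `C`. -/
def ExtMod (_A _C _L _D : Type*) (M : Type*) : Type _ := M

namespace ExtMod

variable (M : Type*) [AddCommGroup M]

instance : AddCommGroup (ExtMod A C L D M) := inferInstanceAs (AddCommGroup M)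

/-- The identity map from `M`, regarded as a right `L`-module, to `M`. -/
def out : ExtMod A C L D M ≃+ M := AddEquiv.refl M

variable [Module Aᵐᵒᵖ M] [RightComodule A C M]

/-- The right `L`-action `m l = m^{[0]} ε(m^{[1]} l)`. -/
instance : Module Lᵐᵒᵖ (ExtMod A C L D M) where
  smul l m := extAct A C L M l m
  one_smul m := extAct_one (M := M) m
  mul_smul l l' m :=
    extAct_mul (M := M) (IsRightCoringExtension.comul_op_smul (D := D)) l l' m
  smul_zero l := map_zero (extAct A C L M l)
  smul_add l := map_add (extAct A C L M l)
  add_smul l l' m := extAct_add (M := M) l l' m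
  zero_smul m := extAct_zero (M := M) m

/-- The `C`-coaction of `M` as a right `L`-linear map. -/
def coactR : ExtMod A C L D M →ₗ[Lᵐᵒᵖ] BalTensor A M C :=
  linOf (M := ExtMod A C L D M) (coact A C M).toAddMonoidHom (fun l m =>
    coact_extAct (M := M) (IsRightCoringExtension.comul_op_smul (D := D)) l m)

/-- `ϱ ⊗_A C : M ⊗_A C → M ⊗_A C ⊗_A C` as a right `L`-linear map. -/
def forkFst : BalTensor A M C →ₗ[Lᵐᵒᵖ] BalTensor A M (BalTensor A C C) :=
  linOf ((assoc A A M C C).toAddMonoidHom.comp (BalTensor.map (coact A C M) LinearMap.id))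
    (fun l x => by
      induction x using BalTensor.induction_on with
      | zero => simp
      | tmul m c =>
        simp only [op_smul_tmul, AddMonoidHom.comp_apply, BalTensor.map_tmul, LinearMap.id_apply]
        generalize coact A C M m = z
        induction z using BalTensor.induction_on with
        | zero => simp
        | tmul m c' => rfl
        | add x y hx hy => simp only [smul_add, BalTensor.add_tmul, map_add, hx, hy]
      | add x y hx hy => simp only [smul_add, map_add, hx, hy])

/-- `M ⊗_A Δ : M ⊗_A C → M ⊗_A C ⊗_A C` as a right `L`-linear map. -/
def forkSnd : BalTensor A M C →ₗ[Lᵐᵒᵖ] BalTensor A M (BalTensor A C C) :=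
  linOf (BalTensor.map LinearMap.id (comulL A C))
    (BalTensor.map_right_smul _ _ (IsRightCoringExtension.comul_op_smul (D := D)))

/-- The functor `- ⊗_L F` preserves the equaliser
`M → M ⊗_A C ⇉ M ⊗_A C ⊗_A C` of right `L`-modules. -/
def PreservesEqualizer (F : Type*) [AddCommGroup F] [Module L F] : Prop :=
  Function.Injective (BalTensor.map (coactR A C L D M) (LinearMap.id : F →ₗ[L] F)) ∧
  Set.range (BalTensor.map (coactR A C L D M) (LinearMap.id : F →ₗ[L] F)) =
    {y | BalTensor.map (forkFst A C L M) (LinearMap.id : F →ₗ[L] F) y =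
      BalTensor.map (forkSnd A C L D M) (LinearMap.id : F →ₗ[L] F) y}

end ExtMod

end Extensions

/-- The right extension `D` of `C` is pure if `- ⊗_L D ⊗_L D` preserves the equaliser
`M → M ⊗_A C ⇉ M ⊗_A C ⊗_A C` for every right `C`-comodule `M`. -/
class IsPureExtension (A C L D : Type u)
    [Ring A] [AddCommGroup C] [Module A C] [Module Aᵐᵒᵖ C] [SMulCommClass A Aᵐᵒᵖ C] [Coring A C]
    [Ring L] [AddCommGroup D] [Module L D] [Module Lᵐᵒᵖ D] [SMulCommClass L Lᵐᵒᵖ D] [Coring L D]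
    [Module Lᵐᵒᵖ C] [SMulCommClass A Lᵐᵒᵖ C] [RightComodule L D C]
    [IsRightCoringExtension A C L D] : Prop where
  pure : ∀ (M : Type u) [AddCommGroup M] [Module Aᵐᵒᵖ M] [RightComodule A C M],
    ExtMod.PreservesEqualizer A C L D M (BalTensor L D D)

namespace ExtMod

section Pure

variable (A C L D : Type u)
  [Ring A] [AddCommGroup C] [Module A C] [Module Aᵐᵒᵖ C] [SMulCommClass A Aᵐᵒᵖ C] [Coring A C]
  [Ring L] [AddCommGroup D] [Module L D] [Module Lᵐᵒᵖ D] [SMulCommClass L Lᵐᵒᵖ D] [Coring L D]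
  [Module Lᵐᵒᵖ C] [SMulCommClass A Lᵐᵒᵖ C] [RightComodule L D C]
  [IsRightCoringExtension A C L D]
  (M : Type u) [AddCommGroup M] [Module Aᵐᵒᵖ M] [RightComodule A C M]

/-- The map `D ⊗_L D → D`, `d ⊗ d' ↦ ε(d) d'`. -/
def counitTensor : BalTensor L D D →ₗ[L] D :=
  linOf ((lid L D).comp (BalTensor.map (counitR L D) LinearMap.id)) (fun l x => by
    induction x using BalTensor.induction_on with
    | zero => simp
    | tmul d d' =>
      have h : counitR L D (l • d) = l • counitR L D d := Coring.counit_smul l d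
      simp [left_smul_tmul, h, mul_smul]
    | add x y hx hy => simp only [smul_add, map_add, hx, hy])

theorem counitTensor_comul : counitTensor L D ∘ₗ comulL L D = LinearMap.id := by
  ext d
  exact Coring.counit_comul d

/-- Purity with respect to `D ⊗_L D` implies purity with respect to the retract `D`. -/
theorem preservesEqualizer_of_pure [IsPureExtension A C L D] :
    PreservesEqualizer A C L D M D := by
  obtain ⟨hinj, hran⟩ := IsPureExtension.pure (A := A) (C := C) (L := L) (D := D) M
  have hret : ∀ {X : Type u} [AddCommGroup X] [Module Lᵐᵒᵖ X] (x : BalTensor L X D),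
      BalTensor.map LinearMap.id (counitTensor L D)
        (BalTensor.map LinearMap.id (comulL L D) x) = x := by
    intro X _ _ x
    rw [BalTensor.map_map, counitTensor_comul]
    exact BalTensor.map_id x
  have hnat : ∀ {X Y F G : Type u} [AddCommGroup X] [Module Lᵐᵒᵖ X] [AddCommGroup Y]
      [Module Lᵐᵒᵖ Y] [AddCommGroup F] [Module L F] [AddCommGroup G] [Module L G]
      (f : X →ₗ[Lᵐᵒᵖ] Y) (g : F →ₗ[L] G) (x : BalTensor L X F),
      BalTensor.map f LinearMap.id (BalTensor.map LinearMap.id g x) =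
        BalTensor.map LinearMap.id g (BalTensor.map f LinearMap.id x) := by
    intro X Y F G _ _ _ _ _ _ _ _ f g x
    rw [BalTensor.map_map, BalTensor.map_map]
    rfl
  refine ⟨fun x y hxy => ?_, ?_⟩
  · rw [← hret x, ← hret y]
    congr 1
    apply hinj
    rw [hnat, hnat, hxy]
  · ext y
    constructor
    · rintro ⟨x, rfl⟩
      have h := Set.mem_range_self (f := BalTensor.map (coactR A C L D M)
        (LinearMap.id : BalTensor L D D →ₗ[L] BalTensor L D D))
        (BalTensor.map LinearMap.id (comulL L D) x)
      rw [hran] at h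
      have h' := congrArg (BalTensor.map LinearMap.id (counitTensor L D)) h
      rwa [hnat, hnat, hnat, hret, hret] at h'
    · intro hy
      have h : BalTensor.map LinearMap.id (comulL L D) y ∈ Set.range
          (BalTensor.map (coactR A C L D M)
            (LinearMap.id : BalTensor L D D →ₗ[L] BalTensor L D D)) := by
        rw [hran]
        change BalTensor.map _ _ _ = BalTensor.map _ _ _
        rw [hnat, hnat, hy]
      obtain ⟨x, hx⟩ := h
      refine ⟨BalTensor.map LinearMap.id (counitTensor L D) x, ?_⟩
      rw [hnat, hx, hret]

/-- `M ⊗_A τ : M ⊗_A C → M ⊗_A C ⊗_L D`, as a right `L`-linear map. -/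
def tensorCoact : BalTensor A M C →ₗ[Lᵐᵒᵖ] BalTensor L (BalTensor A M C) D :=
  linOf ((assoc A L M C D).symm.toAddMonoidHom.comp
      (BalTensor.map LinearMap.id (extCoactL A C L D))) (fun l x => by
    induction x using BalTensor.induction_on with
    | zero => simp
    | tmul m c =>
      have h : extCoactL A C L D (l • c) = l • extCoactL A C L D c := map_smul (coact L D C) l c
      simp only [op_smul_tmul, AddMonoidHom.comp_apply, BalTensor.map_tmul, h]
      generalize extCoactL A C L D c = z
      induction z using BalTensor.induction_on with
      | zero => simp
      | tmul c d => rfl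
      | add x y hx hy => simp only [smul_add, BalTensor.tmul_add, map_add, hx, hy]
    | add x y hx hy => simp only [smul_add, map_add, hx, hy])

theorem tensorCoact_tmul (m : M) (c : C) : tensorCoact A C L D M (tmul A m c) =
    (assoc A L M C D).symm (tmul A m (coact L D C c)) := rfl

theorem tensorCoact_coassoc (x : BalTensor A M C) :
    assoc L L (BalTensor A M C) D D
        (BalTensor.map (tensorCoact A C L D M) LinearMap.id (tensorCoact A C L D M x)) =
      BalTensor.map LinearMap.id (comulL L D) (tensorCoact A C L D M x) := by
  induction x using BalTensor.induction_on with
  | zero => simp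
  | tmul m c =>
    have h1 : ∀ z : BalTensor L C D,
        assoc L L (BalTensor A M C) D D (BalTensor.map (tensorCoact A C L D M) LinearMap.id
          ((assoc A L M C D).symm (tmul A m z))) =
        (assoc A L M C (BalTensor L D D)).symm (tmul A m
          (assoc L L C D D (BalTensor.map (coact L D C) LinearMap.id z))) := by
      intro z
      induction z using BalTensor.induction_on with
      | zero => simp
      | tmul c d =>
        simp only [assoc_symm_tmul, BalTensor.map_tmul, tensorCoact_tmul, LinearMap.id_apply]
        generalize coact L D C c = z
        induction z using BalTensor.induction_on with
        | zero => simp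
        | tmul c c' => rfl
        | add x y hx hy =>
          simp only [BalTensor.add_tmul, BalTensor.tmul_add, map_add, hx, hy]
      | add x y hx hy => simp only [BalTensor.tmul_add, map_add, hx, hy]
    have h2 : ∀ z : BalTensor L C D,
        BalTensor.map LinearMap.id (comulL L D) ((assoc A L M C D).symm (tmul A m z)) =
        (assoc A L M C (BalTensor L D D)).symm (tmul A m
          (BalTensor.map LinearMap.id (comulL L D) z)) := by
      intro z
      induction z using BalTensor.induction_on with
      | zero => simp
      | tmul c c' => rfl
      | add x y hx hy => simp only [BalTensor.tmul_add, map_add, hx, hy]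
    rw [tensorCoact_tmul, h1, h2, coact_coassoc']
  | add x y hx hy => simp only [map_add, hx, hy]

theorem tensorCoact_counit (x : BalTensor A M C) :
    rid L (BalTensor A M C)
      (BalTensor.map LinearMap.id (counitL L D) (tensorCoact A C L D M x)) = x := by
  induction x using BalTensor.induction_on with
  | zero => simp
  | tmul m c =>
    have h : ∀ z : BalTensor L C D, rid L (BalTensor A M C)
        (BalTensor.map LinearMap.id (counitL L D) ((assoc A L M C D).symm (tmul A m z))) =
        tmul A m (rid L C (BalTensor.map LinearMap.id (counitL L D) z)) := by
      intro z
      induction z using BalTensor.induction_on with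
      | zero => simp
      | tmul c c' => rfl
      | add x y hx hy => simp only [BalTensor.tmul_add, map_add, hx, hy]
    rw [tensorCoact_tmul, h, coact_counit']
  | add x y hx hy => simp only [map_add, hx, hy]

/-- `C ⊗_A τ : C ⊗_A C → C ⊗_A C ⊗_L D`, as a left `A`-linear map. -/
def tensorCoactL : BalTensor A C C →ₗ[A] BalTensor L (BalTensor A C C) D :=
  linOf (tensorCoact A C L D C).toAddMonoidHom (fun a x => by
    induction x using BalTensor.induction_on with
    | zero => simp
    | tmul c c' =>
      change (assoc A L C C D).symm (tmul A (a • c) (coact L D C c')) =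
        a • (assoc A L C C D).symm (tmul A c (coact L D C c'))
      generalize coact L D C c' = z
      induction z using BalTensor.induction_on with
      | zero => simp
      | tmul c d => rfl
      | add x y hx hy => simp only [smul_add, BalTensor.tmul_add, map_add, hx, hy]
    | add x y hx hy => simp only [smul_add, map_add, hx, hy])

theorem tensorCoact_forkFst (x : BalTensor A M C) :
    assoc A L M (BalTensor A C C) D (BalTensor.map (forkFst A C L M)
        (LinearMap.id : D →ₗ[L] D) (tensorCoact A C L D M x)) =
      BalTensor.map LinearMap.id (tensorCoactL A C L D) (forkFst A C L M x) := by
  induction x using BalTensor.induction_on with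
  | zero => simp
  | tmul m c =>
    have h : ∀ (y : BalTensor A M C) (z : BalTensor L C D),
        assoc A L M (BalTensor A C C) D ((assoc A L (BalTensor A M C) C D).symm (tmul A y z) |>
          BalTensor.map (linOf (assoc A A M C C).toAddMonoidHom (fun l x => by
            induction x using BalTensor.induction_on with
            | zero => simp
            | tmul y c =>
              induction y using BalTensor.induction_on with
              | zero => simp
              | tmul m c' => rfl
              | add x y hx hy => simp only [smul_add, BalTensor.add_tmul, map_add, hx, hy]
            | add x y hx hy => simp only [smul_add, map_add, hx, hy])) LinearMap.id) =
          BalTensor.map LinearMap.id (linOf (assoc A L C C D).symm.toAddMonoidHom (fun a x => by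
            induction x using BalTensor.induction_on with
            | zero => simp
            | tmul c z =>
              induction z using BalTensor.induction_on with
              | zero => simp
              | tmul c d => rfl
              | add x y hx hy => simp only [smul_add, BalTensor.tmul_add, map_add, hx, hy]
            | add x y hx hy => simp only [smul_add, map_add, hx, hy]))
            (assoc A A M C (BalTensor L C D) (tmul A y z)) := by
      intro y z
      induction y using BalTensor.induction_on with
      | zero => simp
      | tmul m c =>
        induction z using BalTensor.induction_on with
        | zero => simp
        | tmul c d => rfl
        | add x y hx hy => simp only [BalTensor.tmul_add, map_add, hx, hy]
      | add x y hx hy => simp only [BalTensor.add_tmul, map_add, hx, hy]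
    have h1 : BalTensor.map (forkFst A C L M) (LinearMap.id : D →ₗ[L] D)
        (tensorCoact A C L D M (tmul A m c)) =
        ((assoc A L (BalTensor A M C) C D).symm (tmul A (coact A C M m) (coact L D C c)) |>
          BalTensor.map (linOf (assoc A A M C C).toAddMonoidHom (fun l x => by
            induction x using BalTensor.induction_on with
            | zero => simp
            | tmul y c =>
              induction y using BalTensor.induction_on with
              | zero => simp
              | tmul m c' => rfl
              | add x y hx hy => simp only [smul_add, BalTensor.add_tmul, map_add, hx, hy]
            | add x y hx hy => simp only [smul_add, map_add, hx, hy])) LinearMap.id) := by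
      rw [tensorCoact_tmul]
      generalize coact L D C c = z
      induction z using BalTensor.induction_on with
      | zero => simp
      | tmul c d => rfl
      | add x y hx hy => simp only [BalTensor.tmul_add, map_add, hx, hy]
    rw [h1, h]
    change _ = BalTensor.map _ _ (assoc A A M C C (tmul A (coact A C M m) c))
    generalize coact A C M m = y
    induction y using BalTensor.induction_on with
    | zero => simp
    | tmul m c => rfl
    | add x y hx hy => simp only [BalTensor.add_tmul, map_add, hx, hy]
  | add x y hx hy => simp only [map_add, hx, hy]

theorem tensorCoact_forkSnd (x : BalTensor A M C) :
    assoc A L M (BalTensor A C C) D (BalTensor.map (forkSnd A C L D M)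
        (LinearMap.id : D →ₗ[L] D) (tensorCoact A C L D M x)) =
      BalTensor.map LinearMap.id (tensorCoactL A C L D) (forkSnd A C L D M x) := by
  induction x using BalTensor.induction_on with
  | zero => simp
  | tmul m c =>
    have h : ∀ z : BalTensor L C D, assoc A L M (BalTensor A C C) D (BalTensor.map
        (forkSnd A C L D M) (LinearMap.id : D →ₗ[L] D) ((assoc A L M C D).symm (tmul A m z))) =
        tmul A m (BalTensor.map (extComulR A C L D) LinearMap.id z) := by
      intro z
      induction z using BalTensor.induction_on with
      | zero => simp
      | tmul c d => rfl
      | add x y hx hy => simp only [BalTensor.tmul_add, map_add, hx, hy]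
    rw [tensorCoact_tmul, h]
    refine congrArg (tmul A m) ?_
    apply (assoc A L C C D).injective
    refine (IsRightCoringExtension.comul_colinear (A := A) (L := L) (D := D) c).trans ?_
    exact ((assoc A L C C D).apply_symm_apply _).symm
  | add x y hx hy => simp only [map_add, hx, hy]

theorem tensorCoact_equalizes (m : ExtMod A C L D M) :
    BalTensor.map (forkFst A C L M) (LinearMap.id : D →ₗ[L] D)
        (tensorCoact A C L D M (coactR A C L D M m)) =
      BalTensor.map (forkSnd A C L D M) (LinearMap.id : D →ₗ[L] D)
        (tensorCoact A C L D M (coactR A C L D M m)) := by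
  apply (assoc A L M (BalTensor A C C) D).injective
  rw [tensorCoact_forkFst, tensorCoact_forkSnd]
  exact congrArg _ (coact_coassoc' A C (M := M) m)

theorem exists_coaction [IsPureExtension A C L D] (m : ExtMod A C L D M) :
    ∃ y : BalTensor L (ExtMod A C L D M) D,
      BalTensor.map (coactR A C L D M) (LinearMap.id : D →ₗ[L] D) y =
        tensorCoact A C L D M (coactR A C L D M m) := by
  have h : tensorCoact A C L D M (coactR A C L D M m) ∈ Set.range
      (BalTensor.map (coactR A C L D M) (LinearMap.id : D →ₗ[L] D)) := by
    rw [(preservesEqualizer_of_pure A C L D M).2]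
    exact tensorCoact_equalizes A C L D M m
  exact h

variable [IsPureExtension A C L D]

theorem coactR_tensor_injective :
    Function.Injective (BalTensor.map (coactR A C L D M) (LinearMap.id : D →ₗ[L] D)) :=
  (preservesEqualizer_of_pure A C L D M).1

/-- The value of the right `D`-coaction `τ_M : M → M ⊗_L D` of a right `C`-comodule `M`. The
element `τ_M(m)` is the unique one that `ϱ ⊗_L D : M ⊗_L D → M ⊗_A C ⊗_L D` maps to
`m^{[0]} ⊗ τ(m^{[1]})`; this is the meaning of `m^{[0]} ε(m^{[1]}_{[0]}) ⊗ m^{[1]}_{[1]}`. -/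
noncomputable def extCoactFun (m : ExtMod A C L D M) : BalTensor L (ExtMod A C L D M) D :=
  Classical.choose (exists_coaction A C L D M m)

theorem extCoactFun_spec (m : ExtMod A C L D M) :
    BalTensor.map (coactR A C L D M) (LinearMap.id : D →ₗ[L] D) (extCoactFun A C L D M m) =
      tensorCoact A C L D M (coactR A C L D M m) :=
  Classical.choose_spec (exists_coaction A C L D M m)

/-- The right `D`-coaction `τ_M : M → M ⊗_L D` of a right `C`-comodule `M`. -/
noncomputable def extCoact : ExtMod A C L D M →ₗ[Lᵐᵒᵖ] BalTensor L (ExtMod A C L D M) D :=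
  linOf (AddMonoidHom.mk' (extCoactFun A C L D M) (fun m m' => by
      apply coactR_tensor_injective
      rw [map_add (BalTensor.map _ _)]
      simp only [extCoactFun_spec, map_add]))
    (fun l m => by
      apply coactR_tensor_injective
      rw [BalTensor.map_right_smul _ _ (fun _ _ => rfl)]
      change BalTensor.map _ _ (extCoactFun A C L D M (l • m)) =
        l • BalTensor.map _ _ (extCoactFun A C L D M m)
      rw [extCoactFun_spec, extCoactFun_spec, map_smul, map_smul])

/-- For a pure extension, every right `C`-comodule is a right `D`-comodule. -/
noncomputable instance : RightComodule L D (ExtMod A C L D M) where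
  coact := extCoact A C L D M
  coact_coassoc m := by
    have hspec : rTensorOp (coactR A C L D M) ∘ₗ extCoact A C L D M =
        tensorCoact A C L D M ∘ₗ coactR A C L D M :=
      LinearMap.ext (extCoactFun_spec A C L D M)
    have hspec' : BalTensor.map (coactR A C L D M) (LinearMap.id : D →ₗ[L] D)
        (extCoact A C L D M m) = tensorCoact A C L D M (coactR A C L D M m) :=
      extCoactFun_spec A C L D M m
    apply (IsPureExtension.pure (A := A) (C := C) (L := L) (D := D) M).1
    rw [← assoc_rTensorOp, BalTensor.map_map, hspec,
      ← BalTensor.map_map (coactR A C L D M) LinearMap.id, hspec',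
      tensorCoact_coassoc, ← hspec', BalTensor.map_map, BalTensor.map_map]
    rfl
  coact_counit m := by
    have hspec' : BalTensor.map (coactR A C L D M) (LinearMap.id : D →ₗ[L] D)
        (extCoact A C L D M m) = tensorCoact A C L D M (coactR A C L D M m) :=
      extCoactFun_spec A C L D M m
    have hinj : Function.Injective (coactR A C L D M) := by
      intro x y hxy
      have h := congrArg (fun z => rid A M (BalTensor.map LinearMap.id (counitL A C) z)) hxy
      exact ((coact_counit' A C (M := M) x).symm.trans h).trans (coact_counit' A C (M := M) y)
    apply hinj
    rw [← rid_map_map, hspec', tensorCoact_counit]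

end Pure

end ExtMod

section Cleft

variable (A C L D : Type u)
  [Ring A] [AddCommGroup C] [Module A C] [Module Aᵐᵒᵖ C] [SMulCommClass A Aᵐᵒᵖ C] [Coring A C]
  [Ring L] [AddCommGroup D] [Module L D] [Module Lᵐᵒᵖ D] [SMulCommClass L Lᵐᵒᵖ D] [Coring L D]
  [Module Lᵐᵒᵖ C] [SMulCommClass A Lᵐᵒᵖ C] [RightComodule L D C]
  [IsRightCoringExtension A C L D]
  (X : Type u) [AddCommGroup X] [Module Aᵐᵒᵖ X] [RightComodule A C X]

instance ExtMod.leftModule [Module L X] : Module L (ExtMod A C L D X) :=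
  inferInstanceAs (Module L X)

instance ExtMod.endModule : Module (comodEnd A C X) (ExtMod A C L D X) :=
  inferInstanceAs (Module (comodEnd A C X) X)

section EndRing

variable [Module L X] [SMulCommClass L Aᵐᵒᵖ X] [IsBicomodule L A C X]

/-- The unit map `L → T = End^C(X)`, `l ↦ (x ↦ l x)` of the `L`-ring `T`. -/
def unitMap : L →+* comodEnd A C X where
  toFun l := ⟨leftMul l, fun x => IsBicomodule.coact_smul l x⟩
  map_one' := Subtype.ext (LinearMap.ext fun x => one_smul L x)
  map_mul' l l' := Subtype.ext (LinearMap.ext fun x => mul_smul l l' x)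
  map_zero' := Subtype.ext (LinearMap.ext fun x => zero_smul L x)
  map_add' l l' := Subtype.ext (LinearMap.ext fun x => add_smul l l' x)

/-- The right `L`-module structure of the `L`-ring `T = End^C(X)`. -/
instance endRightModule : Module Lᵐᵒᵖ (comodEnd A C X) :=
  Module.compHom _ (unitMap A C L X).op

instance endBimodule : SMulCommClass (comodEnd A C X) Lᵐᵒᵖ (comodEnd A C X) where
  smul_comm s l t := (mul_assoc s t (unitMap A C L X l.unop)).symm

end EndRing

variable {A C X} in
/-- Evaluation at `x` of a left `A`-linear map `q : C → X^* = Hom_A(X, A)`. -/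
def evalLin (q : C →ₗ[A] (X →ₗ[Aᵐᵒᵖ] A)) (x : X) : C →ₗ[A] A where
  toFun c := q c x
  map_add' c c' := by rw [map_add, LinearMap.add_apply]
  map_smul' a c := by rw [map_smul, LinearMap.smul_apply, RingHom.id_apply]

variable [Module L X]

/-- The set `Q̃` of `A`-`L` bilinear maps `q : C → X^* = Hom_A(X, A)`, where
`(a ξ l)(x) = a ξ(l x)`, such that `c^{(1)} q(c^{(2)})(x) = q(c)(x^{[0]}) x^{[1]}`. -/
structure QTilde where
  /-- the underlying left `A`-linear map -/
  toLin : C →ₗ[A] (X →ₗ[Aᵐᵒᵖ] A)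
  map_op_smul : ∀ (l : L) (c : C) (x : X), toLin (op l • c) x = toLin c (l • x)
  comul_eval : ∀ (x : X) (c : C), comulEval (evalLin toLin x) c =
    lid A C (BalTensor.map (toLin c) LinearMap.id (coact A C X x))

variable [IsPureExtension A C L D]

/-- The set `_L Hom^D(D, X)` of left `L`-linear right `D`-colinear maps. -/
structure BicolinearMap where
  /-- the underlying right `L`-linear map -/
  toLin : D →ₗ[Lᵐᵒᵖ] ExtMod A C L D X
  map_smul : ∀ (l : L) (d : D), toLin (l • d) = l • toLin d
  colinear : IsColinear L D toLin

variable {A C L D X}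

/-- The underlying additive map `D → X` of an element of `_L Hom^D(D, X)`. -/
def BicolinearMap.toHom (p : BicolinearMap A C L D X) : D →+ X :=
  (ExtMod.out A C L D X).toAddMonoidHom.comp p.toLin.toAddMonoidHom

theorem BicolinearMap.toHom_smul (p : BicolinearMap A C L D X) (l : L) (d : D) :
    p.toHom (l • d) = l • p.toHom d := p.map_smul l d

/-- The left `A`-linear map `C → A`, `c ↦ q(c_{[0]})(p(c_{[1]}))`. -/
noncomputable def pairing (q : QTilde A C L X) (p : BicolinearMap A C L D X) : C →ₗ[A] A :=
  linOf ((BalTensor.lift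
      (AddMonoidHom.mk' (fun c => (q.toLin c).toAddMonoidHom.comp p.toHom)
        (fun c c' => by
          ext d
          change q.toLin (c + c') (p.toHom d) = q.toLin c (p.toHom d) + q.toLin c' (p.toHom d)
          rw [map_add]
          rfl))
      (fun l c d => by
        change q.toLin (op l • c) (p.toHom d) = q.toLin c (p.toHom (l • d))
        rw [q.map_op_smul, p.toHom_smul])).comp (coact L D C).toAddMonoidHom)
    (fun a c => by
      have h := IsRightCoringExtension.coact_smul (L := L) (D := D) a c
      simp only [AddMonoidHom.comp_apply, h]
      generalize (coact L D C).toAddMonoidHom c = z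
      induction z using BalTensor.induction_on with
      | zero => simp
      | tmul c d =>
        change q.toLin (a • c) (p.toHom d) = a • q.toLin c (p.toHom d)
        rw [map_smul]
        rfl
      | add x y hx hy => simp only [smul_add, map_add, hx, hy])

/-- The connecting map `(q ♦ p)(c) = c^{(1)} q(c^{(2)}_{[0]})(p(c^{(2)}_{[1]}))`. -/
noncomputable def blackDiamond (q : QTilde A C L X) (p : BicolinearMap A C L D X) : C →+ C :=
  coactEval (pairing q p)

/-- For `z = ∑ y ⊗ c` in `X ⊗_A C`, the map `x ↦ ∑ y q(c)(x)`. -/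
def evalTensor (q : C →ₗ[A] (X →ₗ[Aᵐᵒᵖ] A)) (z : BalTensor A X C) : X →ₗ[Aᵐᵒᵖ] X where
  toFun x := rid A X (BalTensor.map LinearMap.id (evalLin q x) z)
  map_add' x y := by
    induction z using BalTensor.induction_on with
    | zero => simp
    | tmul m c => simp [evalLin, add_smul]
    | add z w hz hw => simp only [map_add, hz, hw]; abel
  map_smul' a x := by
    induction z using BalTensor.induction_on with
    | zero => simp
    | tmul m c => simp [evalLin, mul_smul]
    | add z w hz hw => simp only [map_add, hz, hw, smul_add]

theorem evalTensor_mem (q : QTilde A C L X) (y : X) :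
    evalTensor q.toLin (coact A C X y) ∈ comodEnd A C X := by
  intro x
  refine (coact_coactEval (evalLin q.toLin x) y).trans ?_
  have h : ∀ z w : BalTensor A X C, ∀ k : C →ₗ[A] C,
      (∀ c, k c = lid A C (BalTensor.map (q.toLin c) LinearMap.id w)) →
      BalTensor.map LinearMap.id k z =
        BalTensor.map (evalTensor q.toLin z) LinearMap.id w := by
    intro z w k hk
    induction z using BalTensor.induction_on with
    | zero =>
      have h0 : evalTensor q.toLin 0 = (0 : X →ₗ[Aᵐᵒᵖ] X) := by
        ext x
        simp [evalTensor]
      rw [h0]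
      clear hk
      induction w using BalTensor.induction_on with
      | zero => simp
      | tmul m c => simp
      | add z w hz hw => rw [map_add, ← hz, ← hw]; simp
    | tmul m c =>
      rw [BalTensor.map_tmul, hk]
      clear hk
      induction w using BalTensor.induction_on with
      | zero => simp
      | tmul x c' =>
        simp only [BalTensor.map_tmul, lid_tmul, LinearMap.id_apply]
        rw [← BalTensor.smul_tmul]
        rfl
      | add z w hz hw => simp only [map_add, BalTensor.tmul_add, hz, hw]
    | add z z' hz hz' =>
      have h0 : evalTensor q.toLin (z + z') = evalTensor q.toLin z + evalTensor q.toLin z' := by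
        ext x
        simp [evalTensor]
      rw [map_add, hz, hz', h0]
      clear hk hz hz'
      induction w using BalTensor.induction_on with
      | zero => simp
      | tmul m c => simp [BalTensor.add_tmul]
      | add z w hz hw => simp only [map_add, ← hz, ← hw]; abel
  exact h _ _ _ (q.comul_eval x)

/-- The connecting map `(p ♢ q)(d) = p(d)^{[0]} q(p(d)^{[1]})(-)`, with values in
`T = End^C(X)`. -/
noncomputable def whiteDiamond (p : BicolinearMap A C L D X) (q : QTilde A C L X) (d : D) :
    comodEnd A C X :=
  ⟨evalTensor q.toLin (coact A C X (p.toHom d)), evalTensor_mem q (p.toHom d)⟩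

variable (A C L D X)

/-- Weak cleft bicomodules: there are `j` in `_L Hom^D(D, X)` and `q` in `Q̃` such that
`q ♦ j` is the identity map of `C`. -/
def IsWeakCleft : Prop :=
  ∃ (j : BicolinearMap A C L D X) (q : QTilde A C L X), ∀ c : C, blackDiamond q j c = c

variable [SMulCommClass L Aᵐᵒᵖ X] [IsBicomodule L A C X]

/-- Cleft bicomodules: there are `j` in `_L Hom^D(D, X)` and `q` in `Q̃` such that `q ♦ j` is
the identity map of `C` and `j ♢ q = ε_D(-) 1_T`. -/
def IsCleft : Prop :=
  ∃ (j : BicolinearMap A C L D X) (q : QTilde A C L X),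
    (∀ c : C, blackDiamond q j c = c) ∧
    ∀ d : D, whiteDiamond j q d = unitMap A C L X (Coring.counit d)

/-- The normal basis property: `X` is isomorphic to `T ⊗_L D` as a `T`-`D` bicomodule. -/
def HasNormalBasis : Prop :=
  BicomoduleIso (comodEnd A C X) L D (ExtMod A C L D X) (BalTensor L (comodEnd A C X) D)

/-- The weak normal basis property: `X` is isomorphic to a direct summand of `T ⊗_L D` as a
`T`-`D` bicomodule. -/
def HasWeakNormalBasis : Prop :=
  ∃ (N : Type u) (_ : AddCommGroup N) (_ : Module (comodEnd A C X) N) (_ : Module Lᵐᵒᵖ N)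
    (_ : SMulCommClass (comodEnd A C X) Lᵐᵒᵖ N) (_ : RightComodule L D N),
    IsBicomodule (comodEnd A C X) L D N ∧
    BicomoduleIso (comodEnd A C X) L D (ExtMod A C L D X × N)
      (BalTensor L (comodEnd A C X) D)

end Cleft

/-! Write `X` for the comodule Σ, `ϱ` for its `C`-coaction and `τ` for its induced `D`-coaction.
Both sides of the theorem describe the same pair of data: a map `j : D → X`, and a left `T`-linear,
right `L`-linear map `f : X → T` with `f(x_[0])(j(x_[1])) = x`. Such a pair is called a splitting
(`IsSplitting`).

The normal basis side needs no Galois condition. A bicomodule map `T ⊗_L D → X` is determined by its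
restriction `j` to `1 ⊗ D`, and a bicomodule map `X → T ⊗_L D` by its composite `f` with `T ⊗ ε_D`.
A splitting says exactly that `X → T ⊗_L D → X` is the identity, so that `X` is a direct summand
(`hasWeakNormalBasis_iff`). The opposite composite is also the identity when `f(j(d)) = ε_D(d) 1_T`,
and this gives the normal basis property (`hasNormalBasis_iff`).

On the cleft side, applying `ε_C` turns `q ♦ j = id` into `q(c_[0])(j(c_[1])) = ε_C(c)`
(`blackDiamond_eq_id_iff`). Put `f(x) = x^[0] q(x^[1])(-)`. The identity makes `(j, f)` a splitting
(`QTilde.isSplitting`), and it makes `n ⊗ c ↦ n q(c_[0])(-) ⊗ j(c_[1])` a two-sided inverse of the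
canonical map (`isGaloisComodule_of_pairing`).

Conversely, let `X` be Galois with a splitting `(j, f)`. Composing the inverse of `can_N` with `φ ⊗
x ↦ φ ∘ f(x)` gives maps `N ⊗_A C → Hom_A(X, N)` natural in `N`. By naturality they all come from
one map `q : C → X^*`, their value at `N = A`. Since `C` is generated by the elements `φ(x^[0])
x^[1]`, every required identity for `q` can be checked on these, where `q` takes the value `φ ∘
f(x)` (`IsGaloisComodule.exists_qTilde`). This `q` returns `f`, and `(j ♢ q)(d)` is `f(j(d))`, so
the extra condition of cleftness is the extra condition of the normal basis. -/

namespace BalTensor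

/-! ### Additivity of the tensor product of maps -/

section Additivity

variable {R : Type*} {M M' : Type*} {N N' : Type*} [Ring R]
  [AddCommGroup M] [Module Rᵐᵒᵖ M] [AddCommGroup M'] [Module Rᵐᵒᵖ M']
  [AddCommGroup N] [Module R N] [AddCommGroup N'] [Module R N']

theorem map_add_left (f f' : M →ₗ[Rᵐᵒᵖ] M') (g : N →ₗ[R] N') (x : BalTensor R M N) :
    map (f + f') g x = map f g x + map f' g x := by
  induction x using induction_on with
  | zero => simp
  | tmul m n => simp [add_tmul]
  | add x y hx hy => simp only [_root_.map_add, hx, hy]; abel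

theorem map_sub_left (f f' : M →ₗ[Rᵐᵒᵖ] M') (g : N →ₗ[R] N') (x : BalTensor R M N) :
    map (f - f') g x = map f g x - map f' g x := by
  rw [eq_sub_iff_add_eq, ← map_add_left, sub_add_cancel]

end Additivity

end BalTensor

/-! ### Retracts and direct summands of bicomodules -/

section Retracts

variable {S : Type*} {A : Type*} {C : Type*} [Ring S] [Ring A] [AddCommGroup C] [Module A C]
  [Module Aᵐᵒᵖ C] [SMulCommClass A Aᵐᵒᵖ C] [Coring A C]

/-- The comodule structure on a module `N` with a right linear retraction `p` of `i : N → P` such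
that the idempotent map `i ∘ p` of the comodule `P` is colinear. -/
@[reducible] def retractComodule {N P : Type*} [AddCommGroup N] [Module Aᵐᵒᵖ N] [AddCommGroup P]
    [Module Aᵐᵒᵖ P] [RightComodule A C P] (i : N →ₗ[Aᵐᵒᵖ] P) (p : P →ₗ[Aᵐᵒᵖ] N)
    (hpi : ∀ n, p (i n) = n) (hip : IsColinear A C (i ∘ₗ p)) : RightComodule A C N where
  coact := rTensorOp p ∘ₗ coact A C P ∘ₗ i
  coact_coassoc n := by
    -- As `p ∘ i = id`, the idempotent `i ∘ p` fixes `i n`; being colinear, it then fixes the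
    -- coaction of `i n` after tensoring with `C`. This lets coassociativity descend from `P` to
    -- `N`.
    have hi : ∀ n, BalTensor.map i LinearMap.id
        (BalTensor.map p LinearMap.id (coact A C P (i n))) = coact A C P (i n) := fun n => by
      rw [BalTensor.map_map]
      refine (hip (i n)).symm.trans ?_
      rw [LinearMap.comp_apply, hpi]
    change assoc A A N C C (BalTensor.map (rTensorOp p ∘ₗ coact A C P ∘ₗ i) LinearMap.id
      (BalTensor.map p LinearMap.id (coact A C P (i n)))) = BalTensor.map LinearMap.id
        (comulL A C) (BalTensor.map p LinearMap.id (coact A C P (i n)))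
    have h : BalTensor.map (rTensorOp p ∘ₗ coact A C P ∘ₗ i) (LinearMap.id : C →ₗ[A] C)
      (BalTensor.map p LinearMap.id (coact A C P (i n))) =
        BalTensor.map (rTensorOp p) LinearMap.id (BalTensor.map (coact A C P) LinearMap.id
          (BalTensor.map i LinearMap.id
            (BalTensor.map p LinearMap.id (coact A C P (i n))))) := by
      simp only [BalTensor.map_map]
      rfl
    rw [h, hi, assoc_rTensorOp, coact_coassoc', BalTensor.map_map, BalTensor.map_map]
    rfl
  coact_counit n := by
    change rid A N (BalTensor.map LinearMap.id (counitL A C)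
      (BalTensor.map p LinearMap.id (coact A C P (i n)))) = n
    rw [rid_map_map, coact_counit', hpi]

variable (S A C)

/-- For module maps that exhibit `P` as the direct sum of `X` and `N`, where `X → P → X` are maps of
bicomodules, `N` is a bicomodule and a complement of `X`. -/
theorem exists_comodule_complement {X P N : Type*} [AddCommGroup X] [Module Aᵐᵒᵖ X]
    [RightComodule A C X] [Module S X] [AddCommGroup P] [Module Aᵐᵒᵖ P] [RightComodule A C P]
    [Module S P] [SMulCommClass S Aᵐᵒᵖ P] [IsBicomodule S A C P]
    [AddCommGroup N] [Module Aᵐᵒᵖ N] [Module S N] [SMulCommClass S Aᵐᵒᵖ N]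
    (κ : X →ₗ[Aᵐᵒᵖ] P) (hκ : ∀ (s : S) x, κ (s • x) = s • κ x) (hκ' : IsColinear A C κ)
    (μ : P →ₗ[Aᵐᵒᵖ] X) (hμ' : IsColinear A C μ)
    (i : N →ₗ[Aᵐᵒᵖ] P) (hi : ∀ (s : S) x, i (s • x) = s • i x)
    (p : P →ₗ[Aᵐᵒᵖ] N) (hp : ∀ (s : S) x, p (s • x) = s • p x)
    (h : ∀ x, μ (κ x) = x) (hμi : ∀ n, μ (i n) = 0) (hip : ∀ y, i (p y) = y - κ (μ y))
    (hi_inj : Function.Injective i) :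
    ∃ _ : RightComodule A C N, IsBicomodule S A C N ∧ BicomoduleIso S A C (X × N) P := by
  have hpi : ∀ n, p (i n) = n := fun n => hi_inj (by rw [hip, hμi, map_zero, sub_zero])
  have hip0 : i ∘ₗ p = LinearMap.id - κ ∘ₗ μ := LinearMap.ext hip
  have hκμ : ∀ y, coact A C P (κ (μ y)) =
      BalTensor.map (κ ∘ₗ μ) LinearMap.id (coact A C P y) := fun y => by
    rw [hκ', hμ', BalTensor.map_map]
    rfl
  have hip' : IsColinear A C (i ∘ₗ p) := fun y => by
    rw [hip0, BalTensor.map_sub_left, ← hκμ, BalTensor.map_id]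
    exact map_sub (coact A C P) _ _
  -- In general the kernel of a comodule map carries no coaction, because `- ⊗_A C` need not
  -- preserve kernels. Here `N` is cut out by the colinear idempotent `id - κ ∘ μ`, and a retract
  -- does inherit one.
  let _ : RightComodule A C N := retractComodule i p hpi hip'
  have hcoact : ∀ n : N, coact A C N n = BalTensor.map p LinearMap.id (coact A C P (i n)) :=
    fun n => rfl
  have hcoacti : ∀ n, coact A C P (i n) = BalTensor.map i LinearMap.id (coact A C N n) :=
    fun n => by
      rw [hcoact, BalTensor.map_map]
      refine Eq.trans ?_ (hip' (i n))
      rw [LinearMap.comp_apply, hpi]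
  refine ⟨inferInstance, ⟨fun s n => ?_⟩, LinearEquiv.ofLinearMap (LinearMap.coprod κ i)
    (LinearMap.prod μ p) ?_ ?_, ?_, ?_⟩
  · rw [hcoact, hcoact, hi, IsBicomodule.coact_smul, BalTensor.map_left_smul _ _ hp]
  · ext y
    change κ (μ y) + i (p y) = y
    rw [hip, add_sub_cancel]
  · refine LinearMap.ext fun x => Prod.ext ?_ (hi_inj ?_)
    · change μ (κ x.1 + i x.2) = x.1
      rw [map_add, h, hμi, add_zero]
    · change i (p (κ x.1 + i x.2)) = i x.2
      rw [hip, map_add μ, h, hμi, add_zero, add_sub_cancel_left]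
  · intro s x
    change κ (s • x.1) + i (s • x.2) = s • (κ x.1 + i x.2)
    rw [hκ, hi, smul_add]
  · intro x
    change coact A C P (κ x.1 + i x.2) = BalTensor.map (LinearMap.coprod κ i) LinearMap.id
      (BalTensor.map (LinearMap.inl Aᵐᵒᵖ X N) LinearMap.id (coact A C X x.1) +
        BalTensor.map (LinearMap.inr Aᵐᵒᵖ X N) LinearMap.id (coact A C N x.2))
    rw [map_add, map_add, hκ', hcoacti, BalTensor.map_map, BalTensor.map_map,
      LinearMap.coprod_inl, LinearMap.coprod_inr, LinearMap.id_comp]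

/-- A split monomorphism of bicomodules is the inclusion of a direct summand. -/
theorem exists_complement {X P : Type u} [AddCommGroup X] [Module Aᵐᵒᵖ X] [RightComodule A C X]
    [Module S X] [AddCommGroup P] [Module Aᵐᵒᵖ P] [RightComodule A C P] [Module S P]
    [SMulCommClass S Aᵐᵒᵖ P] [IsBicomodule S A C P]
    (κ : X →ₗ[Aᵐᵒᵖ] P) (hκ : ∀ (s : S) x, κ (s • x) = s • κ x) (hκ' : IsColinear A C κ)
    (μ : P →ₗ[Aᵐᵒᵖ] X) (hμ : ∀ (s : S) x, μ (s • x) = s • μ x) (hμ' : IsColinear A C μ)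
    (h : ∀ x, μ (κ x) = x) :
    ∃ (N : Type u) (_ : AddCommGroup N) (_ : Module S N) (_ : Module Aᵐᵒᵖ N)
      (_ : SMulCommClass S Aᵐᵒᵖ N) (_ : RightComodule A C N),
      IsBicomodule S A C N ∧ BicomoduleIso S A C (X × N) P := by
  -- The kernel is formed over `Aᵐᵒᵖ` only; left linearity of `μ` makes it stable under `S`.
  let _ : SMul S (LinearMap.ker μ) := ⟨fun s n => ⟨s • n.1, by
    rw [LinearMap.mem_ker, hμ, LinearMap.mem_ker.1 n.2, smul_zero]⟩⟩
  let _ : Module S (LinearMap.ker μ) := Function.Injective.module S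
    (LinearMap.ker μ).subtype.toAddMonoidHom (LinearMap.ker μ).injective_subtype (fun _ _ => rfl)
  have hcomm : SMulCommClass S Aᵐᵒᵖ (LinearMap.ker μ) :=
    ⟨fun s a n => Subtype.ext (smul_comm s a n.1)⟩
  refine ⟨LinearMap.ker μ, inferInstance, inferInstance, inferInstance, hcomm,
    exists_comodule_complement S A C κ hκ hκ' μ hμ' (LinearMap.ker μ).subtype (fun _ _ => rfl)
      (LinearMap.codRestrict _ (LinearMap.id - κ ∘ₗ μ) (fun x => ?_)) (fun s y => Subtype.ext ?_)
      h (fun n => n.2) (fun _ => rfl) (LinearMap.ker μ).injective_subtype⟩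
  · simp [h]
  · change s • y - κ (μ (s • y)) = s • (y - κ (μ y))
    rw [hμ, hκ, smul_sub]

/-- A direct summand of a bicomodule is the image of a split monomorphism of bicomodules. -/
theorem BicomoduleIso.exists_splitting {X N P : Type*} [AddCommGroup X] [Module Aᵐᵒᵖ X]
    [RightComodule A C X] [Module S X] [AddCommGroup N] [Module Aᵐᵒᵖ N] [RightComodule A C N]
    [Module S N] [AddCommGroup P] [Module Aᵐᵒᵖ P] [RightComodule A C P] [Module S P]
    (h : BicomoduleIso S A C (X × N) P) :
    ∃ (κ : X →ₗ[Aᵐᵒᵖ] P) (μ : P →ₗ[Aᵐᵒᵖ] X), (∀ (s : S) x, κ (s • x) = s • κ x) ∧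
      IsColinear A C κ ∧ (∀ (s : S) x, μ (s • x) = s • μ x) ∧ IsColinear A C μ ∧
      ∀ x, μ (κ x) = x := by
  obtain ⟨e, he, he'⟩ := h
  have hcoact : ∀ x : X × N, coact A C (X × N) x =
      BalTensor.map (LinearMap.inl Aᵐᵒᵖ X N) LinearMap.id (coact A C X x.1) +
        BalTensor.map (LinearMap.inr Aᵐᵒᵖ X N) LinearMap.id (coact A C N x.2) := fun _ => rfl
  refine ⟨e.toLinearMap ∘ₗ LinearMap.inl _ _ _, LinearMap.fst _ _ _ ∘ₗ e.symm.toLinearMap,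
    fun s x => ?_, fun x => ?_, fun s y => ?_, fun y => ?_, fun x => ?_⟩
  · change e (s • x, 0) = s • e (x, 0)
    rw [← he, Prod.smul_mk, smul_zero]
  · refine (he' (x, 0)).trans ?_
    rw [hcoact, map_zero, map_zero, add_zero, BalTensor.map_map]
    rfl
  · obtain ⟨x, rfl⟩ := e.surjective y
    change (e.symm (s • e x)).1 = s • (e.symm (e x)).1
    rw [← he, e.symm_apply_apply, e.symm_apply_apply, Prod.smul_fst]
  · obtain ⟨x, rfl⟩ := e.surjective y
    have h0 : LinearMap.fst Aᵐᵒᵖ X N ∘ₗ e.symm.toLinearMap ∘ₗ e.toLinearMap =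
        LinearMap.fst Aᵐᵒᵖ X N := by
      ext <;> simp
    change coact A C X (e.symm (e x)).1 = BalTensor.map _ _ (coact A C P (e.toLinearMap x))
    rw [he', BalTensor.map_map, LinearMap.comp_assoc, h0, e.symm_apply_apply, hcoact, map_add,
      BalTensor.map_map, BalTensor.map_map, LinearMap.fst_comp_inl, LinearMap.fst_comp_inr,
      LinearMap.id_comp, LinearMap.id_comp, BalTensor.map_id]
    -- The `N`-part of the coaction passes through `fst ∘ inr = 0`, so only the coaction of the
    -- `X`-component survives.
    have hz : ∀ z : BalTensor A N C,
        BalTensor.map (0 : N →ₗ[Aᵐᵒᵖ] X) (LinearMap.id : C →ₗ[A] C) z = 0 := fun z => by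
      induction z using BalTensor.induction_on with
      | zero => simp
      | tmul m c => simp
      | add x y hx hy => rw [map_add, hx, hy, add_zero]
    rw [hz, add_zero]
  · change (e.symm (e (x, 0))).1 = x
    rw [e.symm_apply_apply]

end Retracts

/-! ### The free comodule `N ⊗_A C` and the counit -/

section CounitTensor

variable (A : Type*) (C : Type*) [Ring A] [AddCommGroup C] [Module A C] [Module Aᵐᵒᵖ C]
  [SMulCommClass A Aᵐᵒᵖ C] [Coring A C] (N : Type*) [AddCommGroup N] [Module Aᵐᵒᵖ N]

/-- The map `N ⊗_A ε : N ⊗_A C → N`. -/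
def tensorCounit : BalTensor A N C →ₗ[Aᵐᵒᵖ] N :=
  linOf ((rid A N).comp (BalTensor.map LinearMap.id (counitL A C))) (fun a x => by
    induction x using BalTensor.induction_on with
    | zero => simp
    | tmul n c =>
      have h : counitL A C (a • c) = a • counitL A C c := Coring.counit_op_smul a c
      change op (counitL A C (a • c)) • n = a • op (counitL A C c) • n
      rw [h, ← mul_smul]
      rfl
    | add x y hx hy => simp only [smul_add, map_add, hx, hy])

variable {N}

@[simp] theorem tensorCounit_tmul (n : N) (c : C) :
    tensorCounit A C N (tmul A n c) = op (Coring.counit c : A) • n := rfl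

/-- This is the left counit axiom of `C` tensored with `N`. It recovers a colinear map into `N ⊗_A
C` from its composite with `N ⊗ ε`, which is one half of the cofreeness of `N ⊗_A C`. -/
theorem tensorCounit_freeCoact (x : BalTensor A N C) :
    BalTensor.map (tensorCounit A C N) LinearMap.id (coact A C (BalTensor A N C) x) = x := by
  change BalTensor.map (tensorCounit A C N) LinearMap.id ((assoc A A N C C).symm
    (BalTensor.map LinearMap.id (comulL A C) x)) = x
  induction x using BalTensor.induction_on with
  | zero => simp
  | tmul n c =>
    have h : ∀ z : BalTensor A C C, BalTensor.map (tensorCounit A C N) LinearMap.id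
        ((assoc A A N C C).symm (tmul A n z)) =
        tmul A n (lid A C (BalTensor.map (counitR A C) LinearMap.id z)) := by
      intro z
      induction z using BalTensor.induction_on with
      | zero => simp
      | tmul c c' =>
        rw [assoc_symm_tmul, BalTensor.map_tmul, BalTensor.map_tmul, lid_tmul,
          ← BalTensor.smul_tmul]
        rfl
      | add x y hx hy => simp only [map_add, BalTensor.tmul_add, hx, hy]
    refine (h _).trans ?_
    exact congrArg (tmul A n) (Coring.counit_comul c)
  | add x y hx hy => simp only [map_add, hx, hy]

/-- Linearity of `ε` and of `φ` gives `ε(c^(1) φ(c^(2))) = φ(ε(c^(1)) c^(2))`, and the left counit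
axiom finishes. Hence `φ` can be read off from the endomap of `C` that it induces. -/
theorem counit_coactEval (φ : C →ₗ[A] A) (c : C) : counitL A C (coactEval φ c) = φ c := by
  have h : ∀ z : BalTensor A C C, counitL A C (rid A C (BalTensor.map LinearMap.id φ z)) =
      φ (lid A C (BalTensor.map (counitR A C) LinearMap.id z)) := by
    intro z
    induction z using BalTensor.induction_on with
    | zero => simp
    | tmul c c' =>
      simp only [BalTensor.map_tmul, LinearMap.id_apply, rid_tmul, lid_tmul, map_smul]
      exact Coring.counit_op_smul (op (φ c')) c
    | add x y hx hy => simp only [map_add, hx, hy]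
  exact (h _).trans (congrArg φ (Coring.counit_comul c))

theorem coactEval_counitL {M : Type*} [AddCommGroup M] [Module Aᵐᵒᵖ M] [RightComodule A C M]
    (m : M) : coactEval (counitL A C) m = m := coact_counit' A C m

instance freeComodule_isBicomodule {S : Type*} [Ring S] [Module S N] [SMulCommClass S Aᵐᵒᵖ N] :
    IsBicomodule S A C (BalTensor A N C) where
  coact_smul s x := by
    induction x using BalTensor.induction_on with
    | zero => simp only [smul_zero, map_zero]
    | tmul n c =>
      change (assoc A A N C C).symm (tmul A (s • n) (comulL A C c)) =
        s • (assoc A A N C C).symm (tmul A n (comulL A C c))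
      generalize comulL A C c = z
      induction z using BalTensor.induction_on with
      | zero => simp
      | tmul c c' => rfl
      | add x y hx hy => simp only [BalTensor.tmul_add, map_add, smul_add, hx, hy]
    | add x y hx hy => simp only [smul_add, map_add, hx, hy]

end CounitTensor

/-! ### The induced `L`-action and `D`-coaction, and their compatibility with `T` -/

section ExtComodule

/-- The right `L`-action on a comodule is built from its coaction and from data of `C` alone, so
colinear endomorphisms respect it. -/
theorem map_extAct {A C L X : Type*} [Ring A] [AddCommGroup C] [Module A C] [Module Aᵐᵒᵖ C]
    [SMulCommClass A Aᵐᵒᵖ C] [Coring A C] [Ring L] [Module Lᵐᵒᵖ C] [SMulCommClass A Lᵐᵒᵖ C]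
    [AddCommGroup X] [Module Aᵐᵒᵖ X] [RightComodule A C X]
    {t : X →ₗ[Aᵐᵒᵖ] X} (ht : IsColinear A C t) (l : Lᵐᵒᵖ) (x : X) :
    t (extAct A C L X l x) = extAct A C L X l (t x) := by
  rw [extAct_apply, extAct_apply, ht x, rid_map_map]

variable {A C L D : Type u}
  [Ring A] [AddCommGroup C] [Module A C] [Module Aᵐᵒᵖ C] [SMulCommClass A Aᵐᵒᵖ C] [Coring A C]
  [Ring L] [AddCommGroup D] [Module L D] [Module Lᵐᵒᵖ D] [SMulCommClass L Lᵐᵒᵖ D] [Coring L D]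
  [Module Lᵐᵒᵖ C] [SMulCommClass A Lᵐᵒᵖ C] [RightComodule L D C]
  [IsRightCoringExtension A C L D]
  {X : Type u} [AddCommGroup X] [Module Aᵐᵒᵖ X] [RightComodule A C X]

theorem ExtMod.coact_op_smul (l : Lᵐᵒᵖ) (x : ExtMod A C L D X) :
    coact A C X (l • x : ExtMod A C L D X) = l • coact A C X x :=
  coact_extAct (M := X) (IsRightCoringExtension.comul_op_smul (D := D)) l x

/-- A `C`-colinear endomorphism as a right `L`-linear map. -/
def ExtMod.endMap (t : comodEnd A C X) : ExtMod A C L D X →ₗ[Lᵐᵒᵖ] ExtMod A C L D X :=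
  linOf (M := ExtMod A C L D X) (N := ExtMod A C L D X)
    (t : X →ₗ[Aᵐᵒᵖ] X).toAddMonoidHom (fun l x => map_extAct (X := X) t.2 l x)

instance ExtMod.bimodule : SMulCommClass (comodEnd A C X) Lᵐᵒᵖ (ExtMod A C L D X) where
  smul_comm t l x := map_smul (ExtMod.endMap t) l x

variable [IsPureExtension A C L D]

/-- The characterisation through which every property of `τ` is proved: purity supplies `τ` without
an explicit formula, and only its image under `ϱ ⊗ D` is known. -/
theorem ExtMod.coactR_coact (x : ExtMod A C L D X) :
    BalTensor.map (ExtMod.coactR A C L D X) (LinearMap.id : D →ₗ[L] D)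
        (coact L D (ExtMod A C L D X) x) =
      ExtMod.tensorCoact A C L D X (ExtMod.coactR A C L D X x) :=
  ExtMod.extCoactFun_spec A C L D X x

/-- `C`-colinear endomorphisms are `D`-colinear. -/
theorem ExtMod.endMap_isColinear (t : comodEnd A C X) :
    IsColinear L D (ExtMod.endMap (L := L) (D := D) t) := by
  intro x
  -- Since `τ` is known only after `ϱ ⊗ D`, the two sides are compared there. Purity makes this map
  -- injective, and `h2` reduces the claim to the `C`-colinearity of `t`.
  apply ExtMod.coactR_tensor_injective
  have h1 : ExtMod.coactR A C L D X ∘ₗ ExtMod.endMap t =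
      rTensorOp (t : X →ₗ[Aᵐᵒᵖ] X) ∘ₗ ExtMod.coactR A C L D X := LinearMap.ext t.2
  have h2 : ∀ z : BalTensor A X C,
      ExtMod.tensorCoact A C L D X (BalTensor.map (t : X →ₗ[Aᵐᵒᵖ] X) LinearMap.id z) =
      BalTensor.map (rTensorOp (t : X →ₗ[Aᵐᵒᵖ] X)) LinearMap.id
        (ExtMod.tensorCoact A C L D X z) := by
    intro z
    induction z using BalTensor.induction_on with
    | zero => simp
    | tmul m c =>
      rw [BalTensor.map_tmul, ExtMod.tensorCoact_tmul, ExtMod.tensorCoact_tmul]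
      simp only [LinearMap.id_apply]
      generalize coact L D C c = z
      induction z using BalTensor.induction_on with
      | zero => simp
      | tmul c d => rfl
      | add x y hx hy => simp only [BalTensor.tmul_add, map_add, hx, hy]
    | add x y hx hy => simp only [map_add, hx, hy]
  rw [ExtMod.coactR_coact, BalTensor.map_map, h1, ← BalTensor.map_map _ LinearMap.id,
    ExtMod.coactR_coact, ← h2]
  exact congrArg _ (t.2 x)

instance ExtMod.isBicomodule : IsBicomodule (comodEnd A C X) L D (ExtMod A C L D X) where
  coact_smul t x := ExtMod.endMap_isColinear t x

end ExtComodule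

/-! ### The `L`-ring structure of `T` -/

section UnitMap

variable {A C L X : Type u} [Ring A] [AddCommGroup C] [Module A C] [Module Aᵐᵒᵖ C]
  [SMulCommClass A Aᵐᵒᵖ C] [Coring A C] [Ring L] [AddCommGroup X] [Module Aᵐᵒᵖ X]
  [RightComodule A C X] [Module L X] [SMulCommClass L Aᵐᵒᵖ X] [IsBicomodule L A C X]

theorem unitMap_smul {D : Type u} (l : L) (x : ExtMod A C L D X) : unitMap A C L X l • x = l • x := rfl

theorem op_smul_eq_mul_unitMap (l : L) (t : comodEnd A C X) :
    op l • t = t * unitMap A C L X l := rfl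

end UnitMap

/-! ### Normal bases as splittings -/

section Splitting

variable {A C L D : Type u}
  [Ring A] [AddCommGroup C] [Module A C] [Module Aᵐᵒᵖ C] [SMulCommClass A Aᵐᵒᵖ C] [Coring A C]
  [Ring L] [AddCommGroup D] [Module L D] [Module Lᵐᵒᵖ D] [SMulCommClass L Lᵐᵒᵖ D] [Coring L D]
  [Module Lᵐᵒᵖ C] [SMulCommClass A Lᵐᵒᵖ C] [RightComodule L D C]
  [IsRightCoringExtension A C L D] [IsPureExtension A C L D]
  {X : Type u} [AddCommGroup X] [Module Aᵐᵒᵖ X] [RightComodule A C X]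
  [Module L X] [SMulCommClass L Aᵐᵒᵖ X] [IsBicomodule L A C X]

/-- The map `T ⊗_L D → X`, `t ⊗ d ↦ t(j(d))`. -/
def BicolinearMap.actHom (j : BicolinearMap A C L D X) :
    BalTensor L (comodEnd A C X) D →ₗ[Lᵐᵒᵖ] ExtMod A C L D X :=
  linOf (BalTensor.lift
    (AddMonoidHom.mk' (fun t => (ExtMod.endMap t).toAddMonoidHom.comp j.toLin.toAddMonoidHom)
      (fun t t' => AddMonoidHom.ext fun d => add_smul t t' (j.toLin d)))
    (fun l t d => by
      change (t * unitMap A C L X l) • j.toLin d = t • j.toLin (l • d)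
      rw [j.map_smul, mul_smul, unitMap_smul])) (fun l z => by
    induction z using BalTensor.induction_on with
    | zero => simp
    | tmul t d =>
      change t • j.toLin (l • d) = l • t • j.toLin d
      rw [LinearMap.map_smul, smul_comm]
    | add x y hx hy => simp only [smul_add, map_add, hx, hy])

@[simp] theorem BicolinearMap.actHom_tmul (j : BicolinearMap A C L D X) (t : comodEnd A C X)
    (d : D) : j.actHom (tmul L t d) = t • j.toLin d := rfl

theorem BicolinearMap.actHom_smul (j : BicolinearMap A C L D X) (s : comodEnd A C X)
    (z : BalTensor L (comodEnd A C X) D) : j.actHom (s • z) = s • j.actHom z := by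
  induction z using BalTensor.induction_on with
  | zero => simp only [smul_zero, map_zero]
  | tmul t d => exact mul_smul s t (j.toLin d)
  | add x y hx hy => simp only [smul_add, map_add, hx, hy]

/-- Both ingredients of `t ⊗ d ↦ t(j(d))` are `D`-colinear: `j` by assumption, and `t` because
`C`-colinear endomorphisms are `D`-colinear. -/
theorem BicolinearMap.actHom_isColinear (j : BicolinearMap A C L D X) :
    IsColinear L D j.actHom := by
  intro z
  induction z using BalTensor.induction_on with
  | zero => simp only [map_zero]
  | tmul t d =>
    refine (ExtMod.endMap_isColinear t (j.toLin d)).trans ?_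
    rw [j.colinear d]
    change _ = BalTensor.map _ _ ((assoc L L (comodEnd A C X) D D).symm (tmul L t (coact L D D d)))
    generalize coact L D D d = z
    induction z using BalTensor.induction_on with
    | zero => simp
    | tmul d d' => rfl
    | add x y hx hy => simp only [BalTensor.tmul_add, map_add, hx, hy]
  | add x y hx hy => simp only [map_add, hx, hy]

/-- For a left `T`-linear and right `L`-linear map `f : X → T` and `j` in `_L Hom^D(D, X)`, the
condition `f(x_{[0]})(j(x_{[1]})) = x`. -/
structure IsSplitting (j : BicolinearMap A C L D X)
    (f : ExtMod A C L D X →ₗ[Lᵐᵒᵖ] comodEnd A C X) : Prop where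
  map_smul : ∀ (t : comodEnd A C X) x, f (t • x) = t * f x
  act_coact : ∀ x, j.actHom (BalTensor.map f LinearMap.id (coact L D (ExtMod A C L D X) x)) = x

/-- The elements of `T` act by `D`-colinear maps, so left linearity of `f` passes to `x ↦ f(x_[0]) ⊗
x_[1]`. With `rTensorOp_coact_isColinear` this is a bicomodule map `X → T ⊗_L D`. -/
theorem smul_rTensorOp_coact
    {f : ExtMod A C L D X →ₗ[Lᵐᵒᵖ] comodEnd A C X}
    (hf : ∀ (t : comodEnd A C X) x, f (t • x) = t * f x) (t : comodEnd A C X)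
    (x : ExtMod A C L D X) :
    (rTensorOp f ∘ₗ coact L D (ExtMod A C L D X)) (t • x) =
      t • (rTensorOp f ∘ₗ coact L D (ExtMod A C L D X)) x := by
  change BalTensor.map f LinearMap.id (coact L D (ExtMod A C L D X) (t • x)) =
    t • BalTensor.map f LinearMap.id (coact L D (ExtMod A C L D X) x)
  rw [IsBicomodule.coact_smul, BalTensor.map_left_smul _ _ hf]

/-- A right linear map `f : M → N` on a comodule induces a colinear map `M → N ⊗_A C`,
`m ↦ f(m^{[0]}) ⊗ m^{[1]}`. -/
theorem rTensorOp_coact_isColinear {M N : Type*} [AddCommGroup M] [Module Lᵐᵒᵖ M]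
    [RightComodule L D M] [AddCommGroup N] [Module Lᵐᵒᵖ N] (f : M →ₗ[Lᵐᵒᵖ] N) :
    IsColinear L D (rTensorOp (N := D) f ∘ₗ coact L D M) := by
  intro m
  apply (assoc L L N D D).injective
  have h : BalTensor.map (rTensorOp (N := D) f ∘ₗ coact L D M) (LinearMap.id : D →ₗ[L] D)
      (coact L D M m) = BalTensor.map (rTensorOp f) LinearMap.id
        (BalTensor.map (coact L D M) LinearMap.id (coact L D M m)) := by
    rw [BalTensor.map_map, LinearMap.id_comp]
  rw [h, assoc_rTensorOp, coact_coassoc']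
  refine (AddEquiv.apply_symm_apply _ _).trans ?_
  change BalTensor.map LinearMap.id (comulL L D) (BalTensor.map f LinearMap.id (coact L D M m)) = _
  rw [BalTensor.map_map, BalTensor.map_map]
  rfl

/-- The splitting defined by bicomodule maps `X → T ⊗_L D → X` that compose to the identity. -/
theorem exists_isSplitting
    (κ : ExtMod A C L D X →ₗ[Lᵐᵒᵖ] BalTensor L (comodEnd A C X) D)
    (hκ : ∀ (s : comodEnd A C X) x, κ (s • x) = s • κ x) (hκ' : IsColinear L D κ)
    (μ : BalTensor L (comodEnd A C X) D →ₗ[Lᵐᵒᵖ] ExtMod A C L D X)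
    (hμ : ∀ (s : comodEnd A C X) x, μ (s • x) = s • μ x) (hμ' : IsColinear L D μ)
    (h : ∀ x, μ (κ x) = x) :
    ∃ (j : BicolinearMap A C L D X) (f : ExtMod A C L D X →ₗ[Lᵐᵒᵖ] comodEnd A C X),
      IsSplitting j f ∧ (∀ d, j.toLin d = μ (tmul L 1 d)) ∧
        ∀ x, f x = tensorCounit L D (comodEnd A C X) (κ x) := by
  -- The restriction of `μ` to `1 ⊗ D`, which determines `μ` by left `T`-linearity.
  let jl : D →ₗ[Lᵐᵒᵖ] ExtMod A C L D X :=
    linOf (μ.toAddMonoidHom.comp (BalTensor.mk L (comodEnd A C X) D 1)) (fun l d => by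
      refine Eq.trans ?_ (map_smul μ l (tmul L 1 d))
      rfl)
  have hjl : ∀ d, jl d = μ (tmul L 1 d) := fun _ => rfl
  let j : BicolinearMap A C L D X := ⟨jl, fun l d => by
    -- The left and right actions of `L` agree on `1_T`, so the scalar crosses the tensor sign. Thus
    -- `T`-linearity of `μ` yields left `L`-linearity of `j`.
    have h1 : unitMap A C L X l • tmul L (1 : comodEnd A C X) d = tmul L 1 (l • d) := by
      rw [← BalTensor.smul_tmul, left_smul_tmul, op_smul_eq_mul_unitMap, one_mul, smul_eq_mul,
        mul_one]
    rw [hjl, hjl, ← unitMap_smul, ← hμ, h1], fun d => by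
    rw [hjl, hμ']
    change BalTensor.map _ _ ((assoc L L (comodEnd A C X) D D).symm (tmul L 1 (coact L D D d))) = _
    generalize coact L D D d = z
    induction z using BalTensor.induction_on with
    | zero => simp
    | tmul d d' => rfl
    | add x y hx hy => simp only [BalTensor.tmul_add, map_add, hx, hy]⟩
  have hj : ∀ z, j.actHom z = μ z := by
    intro z
    induction z using BalTensor.induction_on with
    | zero => simp only [map_zero]
    | tmul t d =>
      change t • μ (tmul L 1 d) = μ (tmul L t d)
      rw [← hμ, left_smul_tmul, smul_eq_mul, mul_one]
    | add x y hx hy => simp only [map_add, hx, hy]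
  refine ⟨j, tensorCounit L D (comodEnd A C X) ∘ₗ κ, ⟨fun t x => ?_, fun x => ?_⟩,
    fun _ => rfl, fun _ => rfl⟩
  · rw [LinearMap.comp_apply, LinearMap.comp_apply, hκ]
    generalize κ x = z
    induction z using BalTensor.induction_on with
    | zero => simp
    | tmul s d =>
      rw [left_smul_tmul, tensorCounit_tmul, tensorCounit_tmul, smul_eq_mul,
        op_smul_eq_mul_unitMap, op_smul_eq_mul_unitMap, mul_assoc]
    | add x y hx hy => simp only [smul_add, map_add, mul_add, hx, hy]
  -- With `f = (T ⊗ ε) ∘ κ`, colinearity of `κ` gives `(f ⊗ D) ∘ τ = (T ⊗ ε ⊗ D) ∘ (T ⊗ Δ) ∘ κ = κ`,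
  -- and then `μ ∘ κ = id` applies.
  · rw [hj, ← LinearMap.id_comp (LinearMap.id : D →ₗ[L] D), ← BalTensor.map_map _ LinearMap.id,
      ← hκ', tensorCounit_freeCoact, h]

/-- A direct summand of `T ⊗_L D` is the same as a pair of bicomodule maps `X → T ⊗_L D → X` with
identity composite. The second map is encoded by `j` and the first by `f`, and the splitting
equation is the condition on the composite. -/
theorem hasWeakNormalBasis_iff : HasWeakNormalBasis A C L D X ↔
    ∃ (j : BicolinearMap A C L D X) (f : ExtMod A C L D X →ₗ[Lᵐᵒᵖ] comodEnd A C X),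
      IsSplitting j f := by
  constructor
  · rintro ⟨N, _, _, _, _, _, _, hN⟩
    obtain ⟨κ, μ, hκ, hκ', hμ, hμ', h⟩ := hN.exists_splitting
    obtain ⟨j, f, hjf, -⟩ := exists_isSplitting κ hκ hκ' μ hμ hμ' h
    exact ⟨j, f, hjf⟩
  · rintro ⟨j, f, hjf⟩
    exact exists_complement (comodEnd A C X) L D _ (smul_rTensorOp_coact hjf.map_smul)
      (rTensorOp_coact_isColinear f) j.actHom j.actHom_smul j.actHom_isColinear hjf.act_coact

/-- The additional equation is the other composite, `T ⊗_L D → X → T ⊗_L D`, tested on `1 ⊗ d` after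
`T ⊗ ε`. By `T`-linearity and colinearity this test suffices for that composite to be the identity.
-/
theorem hasNormalBasis_iff : HasNormalBasis A C L D X ↔
    ∃ (j : BicolinearMap A C L D X) (f : ExtMod A C L D X →ₗ[Lᵐᵒᵖ] comodEnd A C X),
      IsSplitting j f ∧ ∀ d, f (j.toLin d) = unitMap A C L X (Coring.counit d) := by
  constructor
  · rintro ⟨e, he, he'⟩
    have hes : ∀ (s : comodEnd A C X) z, e.symm (s • z) = s • e.symm z := fun s z => by
      rw [e.symm_apply_eq, he, e.apply_symm_apply]
    have hec : IsColinear L D e.symm.toLinearMap := fun z => by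
      obtain ⟨x, rfl⟩ := e.surjective z
      change _ = BalTensor.map _ _ (coact L D _ (e.toLinearMap x))
      rw [he', BalTensor.map_map, e.symm_comp]
      change coact L D _ (e.symm (e x)) = _
      rw [e.symm_apply_apply]
      exact (BalTensor.map_id _).symm
    obtain ⟨j, f, hjf, hj, hf⟩ := exists_isSplitting e.toLinearMap he he' e.symm.toLinearMap hes
      hec e.symm_apply_apply
    refine ⟨j, f, hjf, fun d => ?_⟩
    rw [hf, hj]
    change tensorCounit L D (comodEnd A C X) (e (e.symm (tmul L 1 d))) = _
    rw [e.apply_symm_apply, tensorCounit_tmul, op_smul_eq_mul_unitMap, one_mul]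
  · rintro ⟨j, f, hjf, hd⟩
    refine ⟨LinearEquiv.ofLinearMap (rTensorOp f ∘ₗ coact L D (ExtMod A C L D X)) j.actHom ?_
      (LinearMap.ext hjf.act_coact), smul_rTensorOp_coact hjf.map_smul,
      rTensorOp_coact_isColinear f⟩
    refine LinearMap.ext fun z => ?_
    induction z using BalTensor.induction_on with
    | zero => simp only [map_zero]
    | tmul t d =>
      rw [LinearMap.comp_apply, j.actHom_tmul, smul_rTensorOp_coact hjf.map_smul]
      change t • BalTensor.map f LinearMap.id (coact L D _ (j.toLin d)) = tmul L t d
      -- Since `f ∘ j` is `ε(-) 1_T`, the scalar moves to the right factor. At `w = Δ(d)` the counit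
      -- axiom then leaves `1 ⊗ d`.
      have h : ∀ w : BalTensor L D D, BalTensor.map (f ∘ₗ j.toLin) LinearMap.id w =
          tmul L 1 (lid L D (BalTensor.map (counitR L D) LinearMap.id w)) := fun w => by
        induction w using BalTensor.induction_on with
        | zero => simp
        | tmul d d' =>
          rw [BalTensor.map_tmul, LinearMap.comp_apply, hd, BalTensor.map_tmul, lid_tmul,
            ← BalTensor.smul_tmul, op_smul_eq_mul_unitMap, one_mul]
          rfl
        | add x y hx hy => simp only [map_add, BalTensor.tmul_add, hx, hy]
      have h' : lid L D (BalTensor.map (counitR L D) LinearMap.id (coact L D D d)) = d :=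
        Coring.counit_comul d
      rw [j.colinear, BalTensor.map_map, LinearMap.id_comp, h, h', left_smul_tmul, smul_eq_mul,
        mul_one]
    | add x y hx hy => simp only [map_add, hx, hy]

end Splitting

/-! ### The maps `N ⊗_A C → Hom_A(X, N)` induced by `q : C → X^*` -/

section EvalAt

variable {A C X N N' : Type*} [Ring A] [AddCommGroup C] [Module A C]
  [AddCommGroup X] [Module Aᵐᵒᵖ X] [AddCommGroup N] [Module Aᵐᵒᵖ N]
  [AddCommGroup N'] [Module Aᵐᵒᵖ N']

/-- The right linear map `A → N`, `a ↦ n a`. -/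
def orbitMap (n : N) : A →ₗ[Aᵐᵒᵖ] N where
  toFun a := op a • n
  map_add' a b := by rw [op_add, add_smul]
  map_smul' a b := by
    change op (b * a.unop) • n = a • op b • n
    rw [← mul_smul]
    rfl

@[simp] theorem orbitMap_apply (n : N) (a : A) : orbitMap n a = op a • n := rfl

/-- For `q : C → X^*`, the map `N ⊗_A C → Hom_A(X, N)`, `n ⊗ c ↦ n q(c)(-)`. -/
def evalHom (N : Type*) [AddCommGroup N] [Module Aᵐᵒᵖ N] (q : C →ₗ[A] (X →ₗ[Aᵐᵒᵖ] A)) :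
    BalTensor A N C →+ (X →ₗ[Aᵐᵒᵖ] N) :=
  BalTensor.lift
    (AddMonoidHom.mk' (fun n => AddMonoidHom.mk' (fun c => orbitMap n ∘ₗ q c)
        (fun c c' => by ext x; simp [add_smul]))
      (fun n n' => by ext c x; simp))
    (fun a n c => by ext x; simp [mul_smul])

@[simp] theorem evalHom_tmul (q : C →ₗ[A] (X →ₗ[Aᵐᵒᵖ] A)) (n : N) (c : C) :
    evalHom N q (tmul A n c) = orbitMap n ∘ₗ q c := rfl

theorem evalHom_map (q : C →ₗ[A] (X →ₗ[Aᵐᵒᵖ] A)) (g : N →ₗ[Aᵐᵒᵖ] N') (z : BalTensor A N C) :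
    evalHom N' q (BalTensor.map g LinearMap.id z) = g ∘ₗ evalHom N q z := by
  induction z using BalTensor.induction_on with
  | zero => simp
  | tmul n c => ext x; simp
  | add x y hx hy => simp only [map_add, hx, hy, LinearMap.comp_add]

theorem evalHom_op_smul {L : Type*} [Ring L] [Module Lᵐᵒᵖ C] [SMulCommClass A Lᵐᵒᵖ C] [Module L X]
    (q : C →ₗ[A] (X →ₗ[Aᵐᵒᵖ] A)) (hq : ∀ (l : L) (c : C) (x : X), q (op l • c) x = q c (l • x))
    (l : L) (z : BalTensor A N C) (x : X) :
    evalHom N q (op l • z) x = evalHom N q z (l • x) := by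
  induction z using BalTensor.induction_on with
  | zero => simp
  | tmul n c => simp [right_smul_tmul, hq]
  | add x y hx hy => simp only [smul_add, map_add, LinearMap.add_apply, hx, hy]

end EvalAt

section EvalTensor

variable {A C X : Type u} [Ring A] [AddCommGroup C] [Module A C] [AddCommGroup X] [Module Aᵐᵒᵖ X]

theorem evalHom_apply {N : Type*} [AddCommGroup N] [Module Aᵐᵒᵖ N]
    (q : C →ₗ[A] (X →ₗ[Aᵐᵒᵖ] A)) (z : BalTensor A N C) (x : X) :
    evalHom N q z x = rid A N (BalTensor.map LinearMap.id (evalLin q x) z) := by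
  induction z using BalTensor.induction_on with
  | zero => simp
  | tmul n c => rfl
  | add x y hx hy => simp only [map_add, LinearMap.add_apply, hx, hy]

/-- The `T`-valued construction is the case `N = X` of a transformation natural in `N`, so
`evalHom_map` and `evalHom_op_smul` become available for it. -/
theorem evalTensor_eq_evalHom (q : C →ₗ[A] (X →ₗ[Aᵐᵒᵖ] A)) (z : BalTensor A X C) :
    evalTensor q z = evalHom X q z :=
  LinearMap.ext fun x => (evalHom_apply q z x).symm

theorem evalTensor_add (q : C →ₗ[A] (X →ₗ[Aᵐᵒᵖ] A)) (z w : BalTensor A X C) :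
    evalTensor q (z + w) = evalTensor q z + evalTensor q w := by
  simp only [evalTensor_eq_evalHom, map_add]

end EvalTensor

/-- The map `N ⊗_A τ_C : N ⊗_A C → (N ⊗_A C) ⊗_L D`. -/
def tensorExtCoact (A C L D : Type*)
    [Ring A] [AddCommGroup C] [Module A C] [Module Aᵐᵒᵖ C] [SMulCommClass A Aᵐᵒᵖ C] [Coring A C]
    [Ring L] [AddCommGroup D] [Module L D] [Module Lᵐᵒᵖ D] [SMulCommClass L Lᵐᵒᵖ D] [Coring L D]
    [Module Lᵐᵒᵖ C] [SMulCommClass A Lᵐᵒᵖ C] [RightComodule L D C]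
    [IsRightCoringExtension A C L D] (N : Type*) [AddCommGroup N] [Module Aᵐᵒᵖ N] :
    BalTensor A N C →+ BalTensor L (BalTensor A N C) D :=
  (assoc A L N C D).symm.toAddMonoidHom.comp (BalTensor.map LinearMap.id (extCoactL A C L D))

theorem tensorExtCoact_map {A C L D : Type*}
    [Ring A] [AddCommGroup C] [Module A C] [Module Aᵐᵒᵖ C] [SMulCommClass A Aᵐᵒᵖ C] [Coring A C]
    [Ring L] [AddCommGroup D] [Module L D] [Module Lᵐᵒᵖ D] [SMulCommClass L Lᵐᵒᵖ D] [Coring L D]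
    [Module Lᵐᵒᵖ C] [SMulCommClass A Lᵐᵒᵖ C] [RightComodule L D C]
    [IsRightCoringExtension A C L D] {N N' : Type*} [AddCommGroup N] [Module Aᵐᵒᵖ N] [AddCommGroup N']
    [Module Aᵐᵒᵖ N'] (φ : N →ₗ[Aᵐᵒᵖ] N') (z : BalTensor A N C) :
    tensorExtCoact A C L D N' (BalTensor.map φ LinearMap.id z) =
      BalTensor.map (rTensorOp φ) LinearMap.id (tensorExtCoact A C L D N z) := by
  apply (assoc A L N' C D).injective
  rw [assoc_rTensorOp]
  refine ((assoc A L N' C D).apply_symm_apply _).trans ?_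
  refine Eq.trans ?_ (congrArg _ ((assoc A L N C D).apply_symm_apply _).symm)
  rw [BalTensor.map_map, BalTensor.map_map]
  rfl

/-! ### The map `X → T` attached to an element of `Q̃` -/

section EndHom

variable {A C L D : Type u}
  [Ring A] [AddCommGroup C] [Module A C] [Module Aᵐᵒᵖ C] [SMulCommClass A Aᵐᵒᵖ C] [Coring A C]
  [Ring L] [AddCommGroup D] [Module L D] [Module Lᵐᵒᵖ D] [SMulCommClass L Lᵐᵒᵖ D] [Coring L D]
  [Module Lᵐᵒᵖ C] [SMulCommClass A Lᵐᵒᵖ C] [RightComodule L D C]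
  [IsRightCoringExtension A C L D]
  {X : Type u} [AddCommGroup X] [Module Aᵐᵒᵖ X] [RightComodule A C X]
  [Module L X]
  [SMulCommClass L Aᵐᵒᵖ X] [IsBicomodule L A C X]

/-- The map `X → T = End^C(X)`, `x ↦ x^{[0]} q(x^{[1]})(-)`. -/
def QTilde.endHom (q : QTilde A C L X) : ExtMod A C L D X →ₗ[Lᵐᵒᵖ] comodEnd A C X :=
  linOf (M := ExtMod A C L D X) (AddMonoidHom.mk'
      (fun x : X => ⟨evalTensor q.toLin (coact A C X x), evalTensor_mem q x⟩)
      (fun x y => Subtype.ext (by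
        refine Eq.trans ?_ (evalTensor_add q.toLin (coact A C X x) (coact A C X y))
        exact congrArg (evalTensor q.toLin) (map_add (coact A C X) x y))))
    -- The right action of `l` on `T` is precomposition with `y ↦ l y`. It matches the action on `X`
    -- because `ϱ` is right `L`-linear and `q` is right `L`-linear into `X^*`.
    (fun l x => Subtype.ext (LinearMap.ext fun y => by
      change evalTensor q.toLin (coact A C X (l • x : ExtMod A C L D X)) y =
        evalTensor q.toLin (coact A C X x) (l.unop • y)
      rw [evalTensor_eq_evalHom, evalTensor_eq_evalHom, ExtMod.coact_op_smul,
        ← evalHom_op_smul _ q.map_op_smul]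
      rfl))

theorem QTilde.endHom_coe (q : QTilde A C L X) (x : ExtMod A C L D X) :
    (q.endHom x : X →ₗ[Aᵐᵒᵖ] X) = evalHom X q.toLin (coact A C X x) :=
  evalTensor_eq_evalHom _ _

/-- Colinearity of `t` moves it inside the tensor `X ⊗_A C`, and naturality in the module variable
takes it out again as a left factor. -/
theorem QTilde.endHom_smul (q : QTilde A C L X) (t : comodEnd A C X) (x : ExtMod A C L D X) :
    q.endHom (t • x) = t * q.endHom x := by
  refine Subtype.ext ?_
  change (q.endHom (t • x) : X →ₗ[Aᵐᵒᵖ] X) = (t : X →ₗ[Aᵐᵒᵖ] X) ∘ₗ (q.endHom x : X →ₗ[Aᵐᵒᵖ] X)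
  rw [endHom_coe, endHom_coe, ← evalHom_map]
  exact congrArg _ (t.2 x)

end EndHom

/-! ### From the pairing condition to the splitting and the Galois property -/

section Pairing

variable {A C L D : Type u}
  [Ring A] [AddCommGroup C] [Module A C] [Module Aᵐᵒᵖ C] [SMulCommClass A Aᵐᵒᵖ C] [Coring A C]
  [Ring L] [AddCommGroup D] [Module L D] [Module Lᵐᵒᵖ D] [SMulCommClass L Lᵐᵒᵖ D] [Coring L D]
  [Module Lᵐᵒᵖ C] [SMulCommClass A Lᵐᵒᵖ C] [RightComodule L D C]
  [IsRightCoringExtension A C L D] [IsPureExtension A C L D]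
  {X : Type u} [AddCommGroup X] [Module Aᵐᵒᵖ X] [RightComodule A C X]
  [Module L X]

/-- The map `C ⊗_L D → A`, `c ⊗ d ↦ q(c)(j(d))`. -/
def pairingHom (q : QTilde A C L X) (j : BicolinearMap A C L D X) : BalTensor L C D →ₗ[A] A :=
  linOf (BalTensor.lift
    (AddMonoidHom.mk' (fun c => (q.toLin c).toAddMonoidHom.comp j.toHom)
      (fun c c' => by
        ext d
        change q.toLin (c + c') (j.toHom d) = q.toLin c (j.toHom d) + q.toLin c' (j.toHom d)
        rw [map_add]
        rfl))
    (fun l c d => by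
      change q.toLin (op l • c) (j.toHom d) = q.toLin c (j.toHom (l • d))
      rw [q.map_op_smul, j.toHom_smul]))
    (fun a z => by
      induction z using BalTensor.induction_on with
      | zero => simp
      | tmul c d =>
        change q.toLin (a • c) (j.toHom d) = a • q.toLin c (j.toHom d)
        rw [map_smul]
        rfl
      | add x y hx hy => simp only [smul_add, map_add, hx, hy])

theorem pairing_eq (q : QTilde A C L X) (j : BicolinearMap A C L D X) :
    pairing q j = pairingHom q j ∘ₗ extCoactL A C L D := rfl

/-- The map `φ ↦ (c ↦ c^(1) φ(c^(2)))` has left inverse `ε ∘ -` by `counit_coactEval`, and it sends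
`ε` to the identity. So the condition on an endomap of `C` becomes one on a functional `C → A`. -/
theorem blackDiamond_eq_id_iff (q : QTilde A C L X) (j : BicolinearMap A C L D X) :
    (∀ c, blackDiamond q j c = c) ↔ pairing q j = counitL A C := by
  constructor
  · intro h
    ext c
    rw [← counit_coactEval A C (pairing q j) c]
    exact congrArg _ (h c)
  · intro h c
    refine Eq.trans ?_ (coactEval_counitL A C (M := C) c)
    rw [← h]
    rfl

variable [SMulCommClass L Aᵐᵒᵖ X] [IsBicomodule L A C X]

/-- The map `(N ⊗_A C) ⊗_L D → Hom_A(X, N) ⊗_T X`, `n ⊗ c ⊗ d ↦ n q(c)(-) ⊗ j(d)`. -/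
def homTensor (q : QTilde A C L X) (j : BicolinearMap A C L D X) (N : Type*) [AddCommGroup N]
    [Module Aᵐᵒᵖ N] :
    BalTensor L (BalTensor A N C) D →+ BalTensor (comodEnd A C X) (X →ₗ[Aᵐᵒᵖ] N) X :=
  BalTensor.lift
    (AddMonoidHom.mk' (fun z =>
        ((BalTensor.mk (comodEnd A C X) (X →ₗ[Aᵐᵒᵖ] N) X) (evalHom N q.toLin z)).comp j.toHom)
      (fun z w => by
        ext d
        simp only [map_add, AddMonoidHom.add_apply, AddMonoidHom.comp_apply]))
    (fun l z d => by
      change tmul _ (evalHom N q.toLin (op l • z)) (j.toHom d) =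
        tmul _ (evalHom N q.toLin z) (j.toHom (l • d))
      -- Linearity of `q` over `L` exhibits the action of `l` as precomposition by its image in `T`,
      -- which the tensor product over `T` passes to the other factor.
      have h : evalHom N q.toLin (op l • z) =
          op (unitMap A C L X l) • evalHom N q.toLin z :=
        LinearMap.ext (evalHom_op_smul _ q.map_op_smul l z)
      rw [h, BalTensor.smul_tmul, j.toHom_smul]
      rfl)

/-- If `q(c_{[0]})(j(c_{[1]})) = ε(c)`, then `x^{[0]} q(x^{[1]})(-)` and `j` form a splitting. -/
theorem QTilde.isSplitting {q : QTilde A C L X} {j : BicolinearMap A C L D X}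
    (h : pairing q j = counitL A C) : IsSplitting j q.endHom where
  map_smul := q.endHom_smul
  act_coact x := by
    -- `F` is `x ⊗ c ⊗ d ↦ x q(c)(j(d))`. Through it the expression factors over `ϱ ⊗ D`, where `τ`
    -- can be replaced by `X ⊗ τ_C`; the hypothesis then leaves `x^[0] ε(x^[1]) = x`.
    let F : BalTensor L (BalTensor A X C) D →+ X :=
      (rid A X).comp ((BalTensor.map LinearMap.id (pairingHom q j)).comp
        (assoc A L X C D).toAddMonoidHom)
    have h1 : ∀ w : BalTensor L (ExtMod A C L D X) D,
        j.actHom (BalTensor.map q.endHom LinearMap.id w) =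
          F (BalTensor.map (ExtMod.coactR A C L D X) LinearMap.id w) := by
      intro w
      induction w using BalTensor.induction_on with
      | zero => simp only [map_zero]; rfl
      | tmul y d =>
        change (q.endHom y : X →ₗ[Aᵐᵒᵖ] X) (j.toHom d) = F (tmul L (coact A C X y) d)
        rw [QTilde.endHom_coe]
        generalize coact A C X y = z
        induction z using BalTensor.induction_on with
        | zero => simp
        | tmul m c => rfl
        | add x y hx hy => simp only [BalTensor.add_tmul, map_add, LinearMap.add_apply, hx, hy]
      | add x y hx hy => simp only [map_add, hx, hy]; rfl
    rw [h1, ExtMod.coactR_coact]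
    change rid A X (BalTensor.map LinearMap.id (pairingHom q j) (assoc A L X C D
      ((assoc A L X C D).symm
        (BalTensor.map LinearMap.id (extCoactL A C L D) (coact A C X x))))) = x
    rw [(assoc A L X C D).apply_symm_apply, BalTensor.map_map, ← pairing_eq, h]
    exact coact_counit' A C (M := X) x

/-- If `q(c_{[0]})(j(c_{[1]})) = ε(c)`, then `n ⊗ c ↦ n q(c_{[0]})(-) ⊗ j(c_{[1]})` is the inverse
of the canonical map. -/
theorem isGaloisComodule_of_pairing {q : QTilde A C L X} {j : BicolinearMap A C L D X}
    (h : pairing q j = counitL A C) : IsGaloisComodule A C X := by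
  intro N _ _
  refine Function.bijective_iff_has_inverse.2
    ⟨(homTensor q j N).comp (tensorExtCoact A C L D N), fun w => ?_, fun z => ?_⟩
  · induction w using BalTensor.induction_on with
    | zero => simp only [map_zero]
    | tmul φ x =>
      -- By naturality, `n q(c)(-)` evaluated along `φ` and `ϱ` is `φ` composed with an element of
      -- `T`. That element crosses `⊗_T`, so the left-inverse identity reduces to the splitting
      -- equation.
      have h1 : ∀ w : BalTensor L (ExtMod A C L D X) D,
          homTensor q j N (BalTensor.map (rTensorOp φ) LinearMap.id
            (BalTensor.map (ExtMod.coactR A C L D X) LinearMap.id w)) =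
          tmul (comodEnd A C X) φ (ExtMod.out A C L D X
            (j.actHom (BalTensor.map q.endHom LinearMap.id w))) := by
        intro w
        induction w using BalTensor.induction_on with
        | zero => simp
        | tmul y d =>
          change tmul _ (evalHom N q.toLin (BalTensor.map φ LinearMap.id (coact A C X y)))
            (j.toHom d) = tmul _ φ (q.endHom y • j.toHom d)
          rw [evalHom_map, ← QTilde.endHom_coe, ← BalTensor.smul_tmul]
          rfl
        | add x y hx hy => simp only [map_add, BalTensor.tmul_add, hx, hy]
      change homTensor q j N (tensorExtCoact A C L D N
        (BalTensor.map φ LinearMap.id (coact A C X x))) = _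
      rw [tensorExtCoact_map]
      have h2 := ExtMod.coactR_coact (A := A) (C := C) (L := L) (D := D) (X := X) x
      change _ = tensorExtCoact A C L D X (coact A C X x) at h2
      rw [← h2, h1]
      exact congrArg (tmul (comodEnd A C X) φ) ((QTilde.isSplitting h).act_coact x)
    | add x y hx hy => simp only [map_add, hx, hy]
  · induction z using BalTensor.induction_on with
    | zero => simp only [map_zero]
    | tmul n c =>
      -- `H` is `c ⊗ d ↦ c^(1) q(c^(2))(j(d))`. The right-inverse identity reduces to `H ∘ τ_C =
      -- id`.
      let H : BalTensor L C D →+ C :=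
        (rid A C).comp ((BalTensor.map LinearMap.id (pairingHom q j)).comp
          ((assoc A L C C D).toAddMonoidHom.comp
            (BalTensor.map (extComulR A C L D) LinearMap.id)))
      have h1 : ∀ w : BalTensor L C D,
          canMap A C X N (homTensor q j N ((assoc A L N C D).symm (tmul A n w))) =
            tmul A n (H w) := by
        intro w
        induction w using BalTensor.induction_on with
        | zero => simp
        | tmul c d =>
          have h2 : H (tmul L c d) = comulEval (evalLin q.toLin (j.toHom d)) c := by
            change rid A C (BalTensor.map LinearMap.id (pairingHom q j) (assoc A L C C D
              (tmul L (Coring.comul c) d))) = rid A C (BalTensor.map LinearMap.id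
                (evalLin q.toLin (j.toHom d)) (Coring.comul c))
            generalize (Coring.comul c : BalTensor A C C) = z
            induction z using BalTensor.induction_on with
            | zero => simp
            | tmul m c => rfl
            | add x y hx hy => simp only [BalTensor.add_tmul, map_add, hx, hy]
          -- The defining identity of `Q̃` replaces the coproduct of `c` by the coaction of `j(d)`,
          -- which is what the canonical map produces.
          rw [h2, q.comul_eval]
          change BalTensor.map (orbitMap n ∘ₗ q.toLin c) LinearMap.id (coact A C X (j.toHom d)) = _
          generalize coact A C X (j.toHom d) = z
          induction z using BalTensor.induction_on with
          | zero => simp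
          | tmul m c =>
            simp only [BalTensor.map_tmul, lid_tmul, LinearMap.id_apply, LinearMap.comp_apply,
              orbitMap_apply, BalTensor.smul_tmul]
          | add x y hx hy => simp only [map_add, BalTensor.tmul_add, hx, hy]
        | add x y hx hy => simp only [map_add, BalTensor.tmul_add, hx, hy]
      refine (h1 (coact L D C c)).trans (congrArg (tmul A n) ?_)
      -- Colinearity of `Δ_C` moves `τ_C` to the second leg of the coproduct. The pairing is then
      -- applied to `c^(2)` and equals `ε(c^(2))`.
      have h3 : assoc A L C C D (BalTensor.map (extComulR A C L D) LinearMap.id (coact L D C c)) =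
          BalTensor.map LinearMap.id (extCoactL A C L D) (Coring.comul c) :=
        IsRightCoringExtension.comul_colinear c
      change rid A C (BalTensor.map LinearMap.id (pairingHom q j) (assoc A L C C D
        (BalTensor.map (extComulR A C L D) LinearMap.id (coact L D C c)))) = c
      rw [h3, BalTensor.map_map, ← pairing_eq, h]
      exact Coring.comul_counit c
    | add x y hx hy => simp only [map_add, hx, hy]

end Pairing

theorem tmul_one_lid {A C : Type*} [Ring A] [AddCommGroup C] [Module A C] (z : BalTensor A A C) : tmul A (1 : A) (lid A C z) = z := by
  induction z using BalTensor.induction_on with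
  | zero => simp
  | tmul a c =>
    rw [lid_tmul, ← BalTensor.smul_tmul]
    simp
  | add x y hx hy => simp only [map_add, BalTensor.tmul_add, hx, hy]

/-! ### Naturality of the canonical map -/

section Galois

variable {A C : Type*} [Ring A] [AddCommGroup C] [Module A C] [Module Aᵐᵒᵖ C]
  [SMulCommClass A Aᵐᵒᵖ C] [Coring A C]
  {X N N' : Type*} [AddCommGroup X] [Module Aᵐᵒᵖ X] [RightComodule A C X]
  [AddCommGroup N] [Module Aᵐᵒᵖ N] [AddCommGroup N'] [Module Aᵐᵒᵖ N']

theorem canMap_tmul (φ : X →ₗ[Aᵐᵒᵖ] N) (x : X) :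
    canMap A C X N (tmul (comodEnd A C X) φ x) =
      BalTensor.map φ LinearMap.id (coact A C X x) := rfl

/-- Composition with `g : N → N'`, as a right linear map over `T = End^C(X)`. -/
def homComp (g : N →ₗ[Aᵐᵒᵖ] N') : (X →ₗ[Aᵐᵒᵖ] N) →ₗ[(comodEnd A C X)ᵐᵒᵖ] (X →ₗ[Aᵐᵒᵖ] N') where
  toFun φ := g ∘ₗ φ
  map_add' _ _ := LinearMap.comp_add _ _ g
  map_smul' _ _ := rfl

/-- The canonical map is natural. -/
theorem canMap_homComp (g : N →ₗ[Aᵐᵒᵖ] N')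
    (w : BalTensor (comodEnd A C X) (X →ₗ[Aᵐᵒᵖ] N) X) :
    canMap A C X N' (BalTensor.map (homComp g) LinearMap.id w) =
      BalTensor.map g LinearMap.id (canMap A C X N w) := by
  induction w using BalTensor.induction_on with
  | zero => simp
  | tmul φ x =>
    rw [BalTensor.map_tmul, canMap_tmul, canMap_tmul, BalTensor.map_map]
    rfl
  | add x y hx hy => simp only [map_add, hx, hy]

/-- For a left `T`-linear map `f : X → T`, the map `Hom_A(X, N) ⊗_T X → Hom_A(X, N)`,
`φ ⊗ x ↦ φ ∘ f(x)`. -/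
def homEval (N : Type*) [AddCommGroup N] [Module Aᵐᵒᵖ N] (f : X →+ comodEnd A C X)
    (hf : ∀ (t : comodEnd A C X) x, f (t • x) = t * f x) :
    BalTensor (comodEnd A C X) (X →ₗ[Aᵐᵒᵖ] N) X →+ (X →ₗ[Aᵐᵒᵖ] N) :=
  BalTensor.lift
    (AddMonoidHom.mk' (fun φ => AddMonoidHom.mk'
        (fun x => φ ∘ₗ (f x : Module.End Aᵐᵒᵖ X)) (fun x y => by
          rw [map_add]
          exact LinearMap.comp_add _ _ φ))
      (fun φ ψ => by ext x y; rfl))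
    (fun t φ x => by
      change (φ ∘ₗ (t : Module.End Aᵐᵒᵖ X)) ∘ₗ (f x : Module.End Aᵐᵒᵖ X) =
        φ ∘ₗ (f (t • x) : Module.End Aᵐᵒᵖ X)
      rw [hf]
      rfl)

@[simp] theorem homEval_tmul (f : X →+ comodEnd A C X)
    (hf : ∀ (t : comodEnd A C X) x, f (t • x) = t * f x) (φ : X →ₗ[Aᵐᵒᵖ] N) (x : X) :
    homEval N f hf (tmul _ φ x) = φ ∘ₗ (f x : Module.End Aᵐᵒᵖ X) := rfl

theorem homEval_homComp (f : X →+ comodEnd A C X)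
    (hf : ∀ (t : comodEnd A C X) x, f (t • x) = t * f x) (g : N →ₗ[Aᵐᵒᵖ] N')
    (w : BalTensor (comodEnd A C X) (X →ₗ[Aᵐᵒᵖ] N) X) :
    homEval N' f hf (BalTensor.map (homComp g) LinearMap.id w) = g ∘ₗ homEval N f hf w := by
  induction w using BalTensor.induction_on with
  | zero => simp
  | tmul φ x => rfl
  | add x y hx hy => simp only [map_add, hx, hy, LinearMap.comp_add]

end Galois

/-! ### From a splitting of a Galois comodule to an element of `Q̃` -/

section GaloisSplitting

variable {A C : Type u} [Ring A] [AddCommGroup C] [Module A C] [Module Aᵐᵒᵖ C]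
  [SMulCommClass A Aᵐᵒᵖ C] [Coring A C]
  {X : Type u} [AddCommGroup X] [Module Aᵐᵒᵖ X] [RightComodule A C X]

/-- For a Galois comodule `X` and a left `T`-linear map `f : X → T`, the map
`N ⊗_A C → Hom_A(X, N)` that sends `∑ φ_i(x_i^{[0]}) ⊗ x_i^{[1]}` to `∑ φ_i ∘ f(x_i)`. -/
noncomputable def IsGaloisComodule.homEval (hX : IsGaloisComodule A C X)
    (f : X →+ comodEnd A C X) (hf : ∀ (t : comodEnd A C X) x, f (t • x) = t * f x)
    (N : Type u) [AddCommGroup N] [Module Aᵐᵒᵖ N] : BalTensor A N C →+ (X →ₗ[Aᵐᵒᵖ] N) :=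
  (_root_.homEval N f hf).comp (AddEquiv.ofBijective (canMap A C X N) (hX N)).symm.toAddMonoidHom

namespace IsGaloisComodule

variable (hX : IsGaloisComodule A C X) (f : X →+ comodEnd A C X)
  (hf : ∀ (t : comodEnd A C X) x, f (t • x) = t * f x)
  {N : Type u} [AddCommGroup N] [Module Aᵐᵒᵖ N]

theorem homEval_canMap (w : BalTensor (comodEnd A C X) (X →ₗ[Aᵐᵒᵖ] N) X) :
    hX.homEval f hf N (canMap A C X N w) = _root_.homEval N f hf w :=
  congrArg (_root_.homEval N f hf)
    ((AddEquiv.ofBijective (canMap A C X N) (hX N)).symm_apply_apply w)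

/-- Surjectivity of `can_N` reduces this to the naturality of `can` and of `φ ⊗ x ↦ φ ∘ f(x)`. -/
theorem homEval_map {N' : Type u} [AddCommGroup N'] [Module Aᵐᵒᵖ N'] (g : N →ₗ[Aᵐᵒᵖ] N')
    (z : BalTensor A N C) :
    hX.homEval f hf N' (BalTensor.map g LinearMap.id z) = g ∘ₗ hX.homEval f hf N z := by
  obtain ⟨w, rfl⟩ := (hX N).2 z
  rw [← canMap_homComp, homEval_canMap, homEval_canMap, homEval_homComp]

/-- Naturality along `a ↦ n a`, which carries `1 ⊗ c` to `n ⊗ c`. The whole family over `N` is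
thereby controlled by its member at `N = A`, that is, by one map `C → X^*`. -/
theorem homEval_tmul (n : N) (c : C) :
    hX.homEval f hf N (tmul A n c) = orbitMap n ∘ₗ hX.homEval f hf A (tmul A 1 c) := by
  rw [← homEval_map, BalTensor.map_tmul, orbitMap_apply, op_one, one_smul, LinearMap.id_apply]

/-- The map `q : C → X^*` with `q(c) = ∑ φ_i ∘ f(x_i)` for `c = ∑ φ_i(x_i^{[0]}) x_i^{[1]}`. -/
noncomputable def dualMap : C →ₗ[A] (X →ₗ[Aᵐᵒᵖ] A) :=
  linOf ((hX.homEval f hf A).comp (BalTensor.mk A A C 1)) (fun a c => by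
    simp only [AddMonoidHom.comp_apply, BalTensor.mk_apply]
    rw [← BalTensor.smul_tmul, homEval_tmul]
    ext x
    simp)

theorem evalHom_dualMap (z : BalTensor A N C) :
    evalHom N (hX.dualMap f hf) z = hX.homEval f hf N z := by
  induction z using BalTensor.induction_on with
  | zero => simp
  | tmul n c => exact (hX.homEval_tmul f hf n c).symm
  | add x y hx hy => simp only [map_add, hx, hy]

/-- The argument is `can_N(φ ⊗ x)`, so the inverse of `can_N` cancels. The case `φ = id` recovers
`f` from `q`. -/
theorem evalHom_dualMap_coact (φ : X →ₗ[Aᵐᵒᵖ] N) (x : X) :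
    evalHom N (hX.dualMap f hf) (BalTensor.map φ LinearMap.id (coact A C X x)) =
      φ ∘ₗ (f x : Module.End Aᵐᵒᵖ X) := by
  rw [evalHom_dualMap, ← canMap_tmul, homEval_canMap, _root_.homEval_tmul]

/-- The case `N = A` of the preceding formula, read through `A ⊗_A C ≅ C`. It gives `q` on a
generating set of `C`. -/
theorem dualMap_coact (φ : X →ₗ[Aᵐᵒᵖ] A) (x : X) :
    hX.dualMap f hf (lid A C (BalTensor.map φ LinearMap.id (coact A C X x))) =
      φ ∘ₗ (f x : Module.End Aᵐᵒᵖ X) := by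
  rw [← evalHom_dualMap_coact hX f hf,
    ← tmul_one_lid (BalTensor.map φ LinearMap.id (coact A C X x)), evalHom_tmul, tmul_one_lid]
  ext y
  simp

include hX in
/-- The elements `φ(x^{[0]}) x^{[1]}` generate `C`. -/
theorem induction_on {P : C → Prop} (c : C) (zero : P 0)
    (coact : ∀ (φ : X →ₗ[Aᵐᵒᵖ] A) (x : X),
      P (lid A C (BalTensor.map φ LinearMap.id (coact A C X x))))
    (add : ∀ c c', P c → P c' → P (c + c')) : P c := by
  obtain ⟨w, hw⟩ := (hX A).2 (tmul A 1 c)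
  have hc : c = lid A C (canMap A C X A w) := by rw [hw, lid_tmul, one_smul]
  rw [hc]
  clear hw hc
  induction w using BalTensor.induction_on with
  | zero => simpa using zero
  | tmul φ x => exact coact φ x
  | add x y hx hy => simpa using add _ _ hx hy

/-- On a generator `φ(x^[0]) x^[1]`, with `ψ` the map sending `x` to this generator, both sides
equal `ψ(f(x)(y))`: the left by coassociativity of `ϱ`, the right by colinearity of `f(x)`. -/
theorem comulEval_dualMap (y : X) (c : C) : comulEval (evalLin (hX.dualMap f hf) y) c =
    lid A C (BalTensor.map (hX.dualMap f hf c) LinearMap.id (coact A C X y)) := by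
  induction c using hX.induction_on with
  | zero =>
    have h : ∀ z : BalTensor A X C,
        lid A C (BalTensor.map (0 : X →ₗ[Aᵐᵒᵖ] A) LinearMap.id z) = 0 := fun z => by
      induction z using BalTensor.induction_on with
      | zero => simp
      | tmul m c => simp
      | add x y hx hy => rw [map_add, map_add, hx, hy, add_zero]
    rw [map_zero, map_zero, h]
  | add c c' h h' => rw [map_add, map_add, BalTensor.map_add_left, map_add, h, h']
  | coact φ x =>
    -- The map `x ↦ φ(x^[0]) x^[1]` is right `A`-linear, so the formula for `q` can be used with `N
    -- = C`. By `h3` the coproduct of `ψ(x)` is `ψ(x^[0]) ⊗ x^[1]`.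
    let ψ : X →ₗ[Aᵐᵒᵖ] C := linOf ((lid A C).comp
      ((BalTensor.map φ LinearMap.id).comp (coact A C X).toAddMonoidHom)) (fun a x => by
        have h : (coact A C X).toAddMonoidHom (a • x) = a • coact A C X x := (coact A C X).map_smul a x
        rw [AddMonoidHom.comp_apply, AddMonoidHom.comp_apply, h,
          BalTensor.map_right_smul _ _ (fun _ _ => rfl)]
        change _ = a • lid A C (BalTensor.map φ LinearMap.id (coact A C X x))
        generalize BalTensor.map φ LinearMap.id (coact A C X x) = z
        induction z using BalTensor.induction_on with
        | zero => simp
        | tmul b c => simp only [op_smul_tmul, lid_tmul, smul_comm]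
        | add x y hx hy => simp only [smul_add, map_add, hx, hy])
    have hψ : ∀ x, ψ x = lid A C (BalTensor.map φ LinearMap.id (coact A C X x)) := fun _ => rfl
    have h1 : ∀ z : BalTensor A X C,
        comulL A C (lid A C (BalTensor.map φ LinearMap.id z)) =
          lid A (BalTensor A C C) (BalTensor.map φ LinearMap.id
            (BalTensor.map LinearMap.id (comulL A C) z)) := fun z => by
      induction z using BalTensor.induction_on with
      | zero => simp
      | tmul m c => simp
      | add x y hx hy => simp only [map_add, hx, hy]
    have h2 : ∀ z : BalTensor A X C, lid A (BalTensor A C C) (BalTensor.map φ LinearMap.id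
        (assoc A A X C C (BalTensor.map (coact A C X) LinearMap.id z))) =
          BalTensor.map ψ LinearMap.id z := fun z => by
      induction z using BalTensor.induction_on with
      | zero => simp
      | tmul m c =>
        rw [BalTensor.map_tmul, BalTensor.map_tmul, hψ]
        generalize coact A C X m = w
        induction w using BalTensor.induction_on with
        | zero => simp
        | tmul m c => rfl
        | add x y hx hy => simp only [map_add, BalTensor.add_tmul, hx, hy]
      | add x y hx hy => simp only [map_add, hx, hy]
    have h3 : comulL A C (lid A C (BalTensor.map φ LinearMap.id (coact A C X x))) =
        BalTensor.map ψ LinearMap.id (coact A C X x) := by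
      rw [h1, ← coact_coassoc', h2]
    rw [dualMap_coact, ← LinearMap.id_comp (LinearMap.id : C →ₗ[A] C), ← BalTensor.map_map,
      LinearMap.id_comp, ← (f x).2 y, ← hψ]
    change rid A C (BalTensor.map LinearMap.id (evalLin (hX.dualMap f hf) y)
      (comulL A C (lid A C (BalTensor.map φ LinearMap.id (coact A C X x))))) = _
    rw [h3, ← evalHom_apply, evalHom_dualMap_coact]
    rfl

end IsGaloisComodule

variable {L D : Type u}
  [Ring L] [AddCommGroup D] [Module L D] [Module Lᵐᵒᵖ D] [SMulCommClass L Lᵐᵒᵖ D] [Coring L D]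
  [Module Lᵐᵒᵖ C] [SMulCommClass A Lᵐᵒᵖ C] [RightComodule L D C]
  [IsRightCoringExtension A C L D] [IsPureExtension A C L D]
  [Module L X] [SMulCommClass L Aᵐᵒᵖ X] [IsBicomodule L A C X]

/-- Every splitting of a Galois comodule comes from an element of `Q̃`. -/
theorem IsGaloisComodule.exists_qTilde (hX : IsGaloisComodule A C X)
    {j : BicolinearMap A C L D X} {f : ExtMod A C L D X →ₗ[Lᵐᵒᵖ] comodEnd A C X}
    (hf : IsSplitting j f) :
    ∃ q : QTilde A C L X, pairing q j = counitL A C ∧ q.endHom = f := by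
  let f' : X →+ comodEnd A C X :=
    f.toAddMonoidHom.comp (ExtMod.out A C L D X).symm.toAddMonoidHom
  have hf' : ∀ (t : comodEnd A C X) (x : X), f' (t • x) = t * f' x := hf.map_smul
  let q : QTilde A C L X := ⟨hX.dualMap f' hf', fun l c x => by
    induction c using hX.induction_on with
    | zero => simp
    | add c c' h h' => simp only [smul_add, map_add, LinearMap.add_apply, h, h']
    | coact φ y =>
      -- Acting by `l` on the generator given by `φ` and `y` yields the one given by `φ` and `y l`.
      -- Right `L`-linearity of `q` thus follows from that of `f`.
      have h : op l • lid A C (BalTensor.map φ LinearMap.id (coact A C X y)) =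
          lid A C (BalTensor.map φ LinearMap.id
            (coact A C X (ExtMod.out A C L D X (op l • (ExtMod.out A C L D X).symm y)))) := by
        refine Eq.trans ?_ (congrArg (fun z => lid A C (BalTensor.map φ LinearMap.id z))
          (ExtMod.coact_op_smul (D := D) (op l) ((ExtMod.out A C L D X).symm y))).symm
        change _ = lid A C (BalTensor.map φ LinearMap.id (op l • coact A C X y))
        rw [BalTensor.map_right_smul _ _ (fun _ _ => rfl)]
        generalize BalTensor.map φ LinearMap.id (coact A C X y) = z
        induction z using BalTensor.induction_on with
        | zero => simp
        | tmul b c => simp only [op_smul_tmul, lid_tmul, smul_comm]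
        | add x y hx hy => simp only [smul_add, map_add, hx, hy]
      rw [h, hX.dualMap_coact, hX.dualMap_coact]
      have h' : f' (ExtMod.out A C L D X (op l • (ExtMod.out A C L D X).symm y)) =
          f' y * unitMap A C L X l := map_smul f (op l) _
      rw [h']
      rfl, hX.comulEval_dualMap f' hf'⟩
  refine ⟨q, ?_, ?_⟩
  · ext c
    rw [pairing_eq]
    induction c using hX.induction_on with
    | zero => simp only [map_zero]
    | add c c' h h' => simp only [map_add, h, h']
    | coact φ x =>
      -- Applying `φ` to the first factor commutes with the `D`-coactions, as `τ_C` is left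
      -- `A`-linear. So `τ_C` of the generator is computed from `τ` of `x`.
      let Θ : BalTensor A X C →ₗ[Lᵐᵒᵖ] C := linOf ((lid A C).comp (BalTensor.map φ LinearMap.id))
        (fun l z => by
          induction z using BalTensor.induction_on with
          | zero => simp
          | tmul m c =>
            change φ m • l • c = l • φ m • c
            rw [smul_comm]
          | add x y hx hy => simp only [smul_add, map_add, hx, hy])
      have h1 : ∀ z : BalTensor A X C, extCoactL A C L D (Θ z) =
          BalTensor.map Θ LinearMap.id (ExtMod.tensorCoact A C L D X z) := fun z => by
        induction z using BalTensor.induction_on with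
        | zero => simp
        | tmul m c =>
          change extCoactL A C L D (φ m • c) = _
          rw [map_smul, ExtMod.tensorCoact_tmul]
          change φ m • coact L D C c = _
          generalize coact L D C c = w
          induction w using BalTensor.induction_on with
          | zero => simp
          | tmul c d => rfl
          | add x y hx hy => simp only [smul_add, map_add, BalTensor.tmul_add, hx, hy]
        | add x y hx hy => simp only [map_add, hx, hy]
      -- Here `q` is evaluated only on generators, so the pairing becomes `φ` of
      -- `f(x_[0])(j(x_[1]))`. The splitting equation reduces this to `φ(x)`, which by `h4` is also
      -- the counit of the generator.
      have h2 : ∀ w : BalTensor L (ExtMod A C L D X) D,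
          pairingHom q j (BalTensor.map (Θ ∘ₗ ExtMod.coactR A C L D X) LinearMap.id w) =
            φ (ExtMod.out A C L D X (j.actHom (BalTensor.map f LinearMap.id w))) := fun w => by
        induction w using BalTensor.induction_on with
        | zero => simp
        | tmul y d =>
          exact LinearMap.congr_fun (hX.dualMap_coact f' hf' φ (ExtMod.out A C L D X y))
            (j.toHom d)
        | add x y hx hy => simp only [map_add, hx, hy]
      have h3 : extCoactL A C L D (Θ (coact A C X x)) =
          BalTensor.map (Θ ∘ₗ ExtMod.coactR A C L D X) LinearMap.id
            (coact L D (ExtMod A C L D X) ((ExtMod.out A C L D X).symm x)) := by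
        rw [h1, ← LinearMap.id_comp (LinearMap.id : D →ₗ[L] D), ← BalTensor.map_map,
          ExtMod.coactR_coact, LinearMap.id_comp]
        rfl
      have h4 : ∀ z : BalTensor A X C,
          counitL A C (lid A C (BalTensor.map φ LinearMap.id z)) =
            φ (rid A X (BalTensor.map LinearMap.id (counitL A C) z)) := fun z => by
        induction z using BalTensor.induction_on with
        | zero => simp
        | tmul m c => simp
        | add x y hx hy => simp only [map_add, hx, hy]
      rw [h4, coact_counit']
      change pairingHom q j (extCoactL A C L D (Θ (coact A C X x))) = φ x
      rw [h3, h2, hf.act_coact]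
      rfl
  · refine LinearMap.ext fun x => Subtype.ext ?_
    rw [QTilde.endHom_coe]
    have h := hX.evalHom_dualMap_coact f' hf' LinearMap.id (ExtMod.out A C L D X x)
    rw [BalTensor.map_id] at h
    exact h

end GaloisSplitting

theorem mainTheorem1 (A C L D : Type u)
    [Ring A] [AddCommGroup C] [Module A C] [Module Aᵐᵒᵖ C] [SMulCommClass A Aᵐᵒᵖ C] [Coring A C]
    [Ring L] [AddCommGroup D] [Module L D] [Module Lᵐᵒᵖ D] [SMulCommClass L Lᵐᵒᵖ D] [Coring L D]
    [Module Lᵐᵒᵖ C] [SMulCommClass A Lᵐᵒᵖ C] [RightComodule L D C]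
    [IsRightCoringExtension A C L D] [IsPureExtension A C L D]
    (X : Type u) [AddCommGroup X] [Module Aᵐᵒᵖ X] [RightComodule A C X]
    [Module L X] [SMulCommClass L Aᵐᵒᵖ X] [IsBicomodule L A C X] :
    (IsWeakCleft A C L D X ↔ IsGaloisComodule A C X ∧ HasWeakNormalBasis A C L D X) ∧
    (IsCleft A C L D X ↔ IsGaloisComodule A C X ∧ HasNormalBasis A C L D X) := by
  refine ⟨⟨?_, ?_⟩, ⟨?_, ?_⟩⟩
  · rintro ⟨j, q, h⟩
    rw [blackDiamond_eq_id_iff] at h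
    exact ⟨isGaloisComodule_of_pairing h,
      hasWeakNormalBasis_iff.2 ⟨j, q.endHom, QTilde.isSplitting h⟩⟩
  · rintro ⟨hX, h⟩
    obtain ⟨j, f, hf⟩ := hasWeakNormalBasis_iff.1 h
    obtain ⟨q, hq, -⟩ := hX.exists_qTilde hf
    exact ⟨j, q, (blackDiamond_eq_id_iff q j).2 hq⟩
  · rintro ⟨j, q, h, hd⟩
    rw [blackDiamond_eq_id_iff] at h
    -- The hypothesis `hd` serves unchanged, because `whiteDiamond j q d` is by definition
    -- `q.endHom` at `j(d)`.
    exact ⟨isGaloisComodule_of_pairing h,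
      hasNormalBasis_iff.2 ⟨j, q.endHom, QTilde.isSplitting h, hd⟩⟩
  · rintro ⟨hX, h⟩
    obtain ⟨j, f, hf, hd⟩ := hasNormalBasis_iff.1 h
    -- Substituting `q.endHom` for `f` turns the normal basis condition `hd` into the second
    -- cleftness condition.
    obtain ⟨q, hq, rfl⟩ := hX.exists_qTilde hf
    exact ⟨j, q, (blackDiamond_eq_id_iff q j).2 hq, hd⟩
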